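/- Let $(M,\omega)$ be a (finite-dimensional, smooth, Hausdorff) symplectic manifold and $H\in C^\infty(M)$, with Hamiltonian vector field $X_H$ defined by $i_{X_H}\omega=-dH$. Let $\mathbf D$ be a smooth vector field on $M$ which is a scaling symmetry of degree one, i.e. $L_{\mathbf D}\omega=\omega$ and $L_{\mathbf D}H=H$, and set $\lambda:=i_{\mathbf D}\omega$. Assume that the quotient $C:=M/\mathbf D$ of $M$ by the relation "lying on a common integral curve of $\mathbf D$" is a smooth manifold for which the projection $\pi:M\to C$ is a smooth submersion. Then: (i) $X_H$ descends to $C$: there is a unique smooth vector field $X=\pi_*X_H$ on $C$ with $d\pi_m(X_H(m))=X(\pi(m))$ for all $m\in M$. (ii) Let $\rho:M\to\mathbb R\setminus\{0\}$ be any global scaling function, i.e. a smooth nowhere vanishing function with $L_{\mathbf D}\rho=\rho$. Then there are a unique contact form $\eta$ on $C$ with $\pi^*\eta=\lambda/\rho$ and a unique smooth function $\mathscr H$ on $C$ with $\pi^*\mathscr H=-H/\rho$, and $X$ is the contact Hamiltonian vector field of $\mathscr H$ with respect to $\eta$, i.e. $$i_X\,d\eta=d\mathscr H-\mathscr R(\mathscr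 H)\,\eta,\qquad i_X\eta=-\mathscr H,$$ where $\mathscr R$ is the Reeb vector field of $\eta$ ($i_{\mathscr R}d\eta=0$, $i_{\mathscr R}\eta=1$). -/

import Mathlib

open scoped Manifold ContDiff Topology

noncomputable section

namespace ScalingReduction

section Forms

variable (E : Type*) [NormedAddCommGroup E] [NormedSpace ℝ E]
  (M : Type*) [TopologicalSpace M] [ChartedSpace E M]

/-- Fields of tangent vectors on a manifold `M` modelled on `E` (no regularity required). -/
abbrev VField : Type _ := (x : M) → TangentSpace 𝓘(ℝ, E) x

/-- Differential `k`-forms on a manifold `M` modelled on `E` (no regularity required). -/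
abbrev DForm (k : ℕ) : Type _ := (x : M) → TangentSpace 𝓘(ℝ, E) x [⋀^Fin k]→L[ℝ] ℝ

variable {E M}

/-- Smooth vector fields: smooth sections of the tangent bundle. -/
def VField.Smooth [IsManifold 𝓘(ℝ, E) ∞ M] (X : VField E M) : Prop :=
  ContMDiff 𝓘(ℝ, E) (𝓘(ℝ, E).prod 𝓘(ℝ, E)) ∞
    (fun x => (⟨x, X x⟩ : TangentBundle 𝓘(ℝ, E) M))

/-- The expression of a vector field in the preferred chart around `x₀`. -/
def VField.inChart (X : VField E M) (x₀ : M) : E → E := fun y =>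
  mfderiv 𝓘(ℝ, E) 𝓘(ℝ, E) (extChartAt 𝓘(ℝ, E) x₀) ((extChartAt 𝓘(ℝ, E) x₀).symm y)
    (X ((extChartAt 𝓘(ℝ, E) x₀).symm y))

/-- The expression of a form in the preferred chart `φ` around `x₀`, i.e. its pull-back under
`φ⁻¹`. -/
def DForm.inChart {k : ℕ} (α : DForm E M k) (x₀ : M) : E → E [⋀^Fin k]→L[ℝ] ℝ := fun y =>
  (α ((extChartAt 𝓘(ℝ, E) x₀).symm y)).compContinuousLinearMap
    (mfderiv 𝓘(ℝ, E) 𝓘(ℝ, E) (extChartAt 𝓘(ℝ, E) x₀).symm y)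

/-- Smooth forms: smooth in every preferred chart. -/
def DForm.Smooth {k : ℕ} (α : DForm E M k) : Prop :=
  ∀ x₀ : M, ContDiffOn ℝ ∞ (α.inChart x₀) (extChartAt 𝓘(ℝ, E) x₀).target

/-- The exterior derivative `dα`, computed at `x` in the preferred chart around `x`. -/
def DForm.d {k : ℕ} (α : DForm E M k) : DForm E M (k + 1) := fun x =>
  (extDeriv (α.inChart x) (extChartAt 𝓘(ℝ, E) x x)).compContinuousLinearMap
    (mfderiv 𝓘(ℝ, E) 𝓘(ℝ, E) (extChartAt 𝓘(ℝ, E) x) x)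

/-- The interior product `i_X α = α(X, ·, …, ·)`. -/
def DForm.interior {k : ℕ} (X : VField E M) (α : DForm E M (k + 1)) : DForm E M k := fun x =>
  let a : E [⋀^Fin (k + 1)]→L[ℝ] ℝ := α x
  let u : E := X x
  a.curryLeft u

/-- The Lie derivative `(L_X α)_x (v₁, …, v_k)`, by its coordinate expression
`(D_X α)(v₁, …, v_k) + ∑ i, α(v₁, …, D_{v i} X, …, v_k)`
in the preferred chart around `x`. -/
def DForm.lieDeriv {k : ℕ} (X : VField E M) (α : DForm E M k) (x : M)
    (v : Fin k → TangentSpace 𝓘(ℝ, E) x) : ℝ :=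
  let y : E := extChartAt 𝓘(ℝ, E) x x
  let w : Fin k → E := fun i => mfderiv 𝓘(ℝ, E) 𝓘(ℝ, E) (extChartAt 𝓘(ℝ, E) x) x (v i)
  fderiv ℝ (α.inChart x) y (X.inChart x y) w +
    ∑ i, α.inChart x y (Function.update w i (fderiv ℝ (X.inChart x) y (w i)))

/-- The differential `df_x(v)` of a real function. Applied to `v = X x`, it is `(L_X f)(x)`. -/
def dfun (f : M → ℝ) (x : M) (v : TangentSpace 𝓘(ℝ, E) x) : ℝ :=
  mfderiv 𝓘(ℝ, E) 𝓘(ℝ, ℝ) f x v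

end Forms

section Symplectic

variable {E : Type*} [NormedAddCommGroup E] [NormedSpace ℝ E]
  {M : Type*} [TopologicalSpace M] [ChartedSpace E M]

/-- Symplectic forms: smooth, closed, non-degenerate 2-forms. -/
structure IsSymplectic (Ω : DForm E M 2) : Prop where
  smooth : Ω.Smooth
  closed : Ω.d = 0
  nondegenerate : ∀ x (u : TangentSpace 𝓘(ℝ, E) x), (∀ v, Ω x ![u, v] = 0) → u = 0

/-- The Hamiltonian vector field `X_H`, defined by `i_{X_H} Ω = -dH`. -/
def hamiltonianVF (Ω : DForm E M 2) (H : M → ℝ) : VField E M := fun x =>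
  Classical.epsilon fun u => ∀ v, Ω x ![u, v] = -dfun H x v

/-- The defining equation of `X_H` holds for a symplectic form, and determines `X_H`. -/
theorem hamiltonianVF_spec [FiniteDimensional ℝ E] {Ω : DForm E M 2} (hΩ : IsSymplectic Ω)
    (H : M → ℝ) (x : M) (u : TangentSpace 𝓘(ℝ, E) x) :
    (∀ v, Ω x ![u, v] = -dfun H x v) ↔ u = hamiltonianVF Ω H x := by
  let a₀ : E [⋀^Fin 2]→L[ℝ] ℝ := Ω x
  have hup : ∀ a b c : E, Function.update ![a, b] 1 c = ![a, c] := fun a b c => by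
    ext i; fin_cases i <;> rfl
  let B : E →ₗ[ℝ] Module.Dual ℝ E := LinearMap.mk₂ ℝ (fun u v : E => a₀ ![u, v])
    (fun a b v => a₀.map_vecCons_add ![v] a b)
    (fun c a v => a₀.map_vecCons_smul ![v] c a)
    (fun a v w => by
      have h := a₀.map_update_add ![a, v] 1 v w
      rwa [hup, hup, hup] at h)
    (fun c a v => by
      have h := a₀.map_update_smul ![a, v] 1 c v
      rwa [hup, hup] at h)
  have hinj : Function.Injective B := by
    refine (injective_iff_map_eq_zero B).2 fun a ha => hΩ.nondegenerate x a fun v => ?_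
    exact LinearMap.congr_fun ha v
  have hsurj : Function.Surjective B :=
    (LinearMap.injective_iff_surjective_of_finrank_eq_finrank
      (Subspace.dual_finrank_eq (K := ℝ) (V := E)).symm).1 hinj
  let g : E →L[ℝ] ℝ := mfderiv 𝓘(ℝ, E) 𝓘(ℝ, ℝ) H x
  let f : Module.Dual ℝ E := -(g : E →ₗ[ℝ] ℝ)
  have hf : ∀ v : E, f v = -dfun (E := E) H x v := fun _ => rfl
  obtain ⟨a, ha⟩ := hsurj f
  have hex : ∃ u : TangentSpace 𝓘(ℝ, E) x, ∀ v, Ω x ![u, v] = -dfun H x v :=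
    ⟨a, fun v => (LinearMap.congr_fun ha v).trans (hf v)⟩
  have hsp := Classical.epsilon_spec hex
  constructor
  · intro hu
    refine hinj (LinearMap.ext fun v => ?_)
    exact (hu v).trans (hsp v).symm
  · rintro rfl
    exact hsp

/-- `D` is a scaling symmetry of degree `Λ` of the Hamiltonian system `(M, Ω, H)`:
`L_D Ω = Ω` and `L_D H = Λ H`. -/
structure IsScalingSymmetry [IsManifold 𝓘(ℝ, E) ∞ M] (Ω : DForm E M 2) (H : M → ℝ) (D : VField E M) (Λ : ℝ) :
    Prop where
  smooth : D.Smooth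
  form : ∀ x v, DForm.lieDeriv D Ω x v = Ω x v
  hamiltonian : ∀ x, dfun H x (D x) = Λ * H x

/-- Global scaling functions `ρ : M → ℝ \ {0}` of `D`: smooth functions with `L_D ρ = ρ`. -/
structure IsScalingFunction (D : VField E M) (ρ : M → ℝ) : Prop where
  smooth : ContMDiff 𝓘(ℝ, E) 𝓘(ℝ, ℝ) ∞ ρ
  ne_zero : ∀ x, ρ x ≠ 0
  scaling : ∀ x, dfun ρ x (D x) = ρ x

/-- `m` and `m'` lie on a common integral curve of `D`, defined on some open interval `s`. -/
def OnCommonIntegralCurve (D : VField E M) (m m' : M) : Prop :=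
  ∃ (γ : ℝ → M) (s : Set ℝ), IsOpen s ∧ s.OrdConnected ∧ IsMIntegralCurveOn γ D s ∧
    ∃ t ∈ s, ∃ t' ∈ s, γ t = m ∧ γ t' = m'

end Symplectic

section Quotient

variable {E : Type*} [NormedAddCommGroup E] [NormedSpace ℝ E]
  {M : Type*} [TopologicalSpace M] [ChartedSpace E M]
  {F : Type*} [NormedAddCommGroup F] [NormedSpace ℝ F]
  {C : Type*} [TopologicalSpace C] [ChartedSpace F C]

/-- The manifold `C` is the quotient `M / D` with projection `π`: the points of `C` are the
classes of points of `M` on a common integral curve of `D`, and `π` is a smooth submersion. -/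
structure IsQuotientBy (D : VField E M) (π : M → C) : Prop where
  submersion : Manifold.IsSubmersion 𝓘(ℝ, E) 𝓘(ℝ, F) ∞ π
  surjective : Function.Surjective π
  fiber : ∀ m m', π m = π m' ↔ OnCommonIntegralCurve D m m'

/-- The pull-back `π^* α`. -/
def DForm.pullback {k : ℕ} (π : M → C) (α : DForm F C k) : DForm E M k := fun m =>
  (α (π m)).compContinuousLinearMap (mfderiv 𝓘(ℝ, E) 𝓘(ℝ, F) π m)

/-- `X = π_* Y`: `X` is a (smooth) vector field on `C` and `dπ(Y_m) = X_{π(m)}` for all `m`. -/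
structure IsPushforward [IsManifold 𝓘(ℝ, F) ∞ C] (π : M → C) (Y : VField E M) (X : VField F C) :
    Prop where
  smooth : X.Smooth
  related : ∀ m, mfderiv 𝓘(ℝ, E) 𝓘(ℝ, F) π m (Y m) = X (π m)

end Quotient

section Contact

variable {F : Type*} [NormedAddCommGroup F] [NormedSpace ℝ F]
  {C : Type*} [TopologicalSpace C] [ChartedSpace F C]

/-- Contact 1-forms: smooth, nowhere vanishing, with maximally non-integrable kernel, i.e. `dη` is
non-degenerate on `ker η` (equivalently `η ∧ (dη)^n ≠ 0`, with `dim C = 2n + 1`). -/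
structure IsContactForm (η : DForm F C 1) : Prop where
  smooth : η.Smooth
  ne_zero : ∀ x, η x ≠ 0
  nondegenerate : ∀ x (u : TangentSpace 𝓘(ℝ, F) x), η x ![u] = 0 →
    (∀ v, η x ![v] = 0 → η.d x ![u, v] = 0) → u = 0

/-- `R` is the Reeb vector field of `η`: `i_R dη = 0` and `i_R η = 1`. -/
structure IsReeb (η : DForm F C 1) (R : VField F C) : Prop where
  d_eq : ∀ x v, η.d x ![R x, v] = 0
  eq_one : ∀ x, η x ![R x] = 1

/-- `X` is the contact Hamiltonian vector field of `h` with respect to `η`: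
`i_X dη = dh - R(h) η` and `i_X η = -h`, with `R` the Reeb vector field of `η`. -/
def IsContactHamiltonianVF (η : DForm F C 1) (h : C → ℝ) (X : VField F C) : Prop :=
  ∃ R : VField F C, IsReeb η R ∧
    (∀ x v, η.d x ![X x, v] = dfun h x v - dfun h x (R x) * η x ![v]) ∧
    ∀ x, η x ![X x] = -h x

end Contact

end ScalingReduction

end

/-!
# Reduction of a Hamiltonian system by a scaling symmetry

The objects on `M` which are constant along the integral curves of `D` descend to `C = M / D`.

* *The fibers.* By Picard-Lindelöf every point lies on an integral curve of `D`, along which `π` is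
  constant, so `dπ(D) = 0`. Conversely, uniqueness of integral curves on a Hausdorff manifold makes
  each fiber the image of one curve (`exists_maximal_curve`). A differentiable curve has an image of
  measure zero in dimension at least two, so in a chart where `π` is a linear projection the fibers
  have dimension at most one (`finrank_le_of_quotient`). Hence `ker dπ = ℝ D` wherever `D ≠ 0`
  (`exists_smul_of_tmap_eq_zero`); a scaling function forces `D ≠ 0` everywhere.

* *The vector field.* From `L_D Ω = Ω` and `L_D H = H` one gets `[D, X_H] = 0`
  (`fderiv_comm_of_scaling`). Together with `dπ(D) = 0` and the symmetry of second derivatives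
  this says that `dπ(X_H)` has zero derivative along `D` (`fderiv_proj_eq_zero`), so it is constant
  on fibers (`tmap_hamiltonianVF_eq`). Smoothness on `C` comes from smooth local sections of `π`.

* *The contact form.* `β = λ / ρ` kills `ker dπ = ℝ D`, because `Ω(D, D) = 0`, and satisfies
  `L_D β = 0` (`lieDeriv_scaled_interior`), so it is the pull-back of a form `η`
  (`scaledForm_eq_of_tmap_eq`). Since `Ω` is closed, Cartan's formula `dλ = L_D Ω = Ω` gives
  `ρ π^*dη = Ω - dρ ∧ β` (`extDeriv_scaled_interior`, `mul_d_apply`). So `dη` is, up to a factor,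
  `Ω` on the kernel of `λ = Ω(D, ·)`, and its degenerate directions there are multiples of `D`,
  which project to zero (`isContactForm_of_pullback`).

* *The contact Hamiltonian field.* The Reeb field is the projection of `X_ρ`. Evaluating
  `ρ π^*dη = Ω - dρ ∧ β` on `X_ρ` and `X_H`, and using `ρ · π^*h = -H`, gives the remaining
  identities pointwise (`isContactHamiltonianVF_of_pullback`).

Derivatives are computed in the preferred charts; all the infinitesimal identities are needed only
at the centre of a chart, since constancy along a curve may be checked in the chart around each of
its points (`eq_on_curve`).
-/

noncomputable section

namespace ScalingReduction

/-! ### Differentials, vector fields and forms in charts -/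

theorem ne_zero_inf : (∞ : WithTop ℕ∞) ≠ 0 := by simp

section ChartCalculus

variable {E : Type*} [NormedAddCommGroup E] [NormedSpace ℝ E]
  {M : Type*} [TopologicalSpace M] [ChartedSpace E M]
  {F : Type*} [NormedAddCommGroup F] [NormedSpace ℝ F]
  {C : Type*} [TopologicalSpace C] [ChartedSpace F C]
  {G : Type*} [NormedAddCommGroup G] [NormedSpace ℝ G]
  {N : Type*} [TopologicalSpace N] [ChartedSpace G N]

/-- The differential of a map between manifolds, as a linear map between the model spaces. All
tangent spaces `TangentSpace 𝓘(ℝ, E) x` are copies of `E`; forgetting the base point makes chain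
rules and comparisons between different base points type-correct on the nose. -/
def tmap (E : Type*) [NormedAddCommGroup E] [NormedSpace ℝ E] {M : Type*} [TopologicalSpace M]
    [ChartedSpace E M] (F : Type*) [NormedAddCommGroup F] [NormedSpace ℝ F] {C : Type*}
    [TopologicalSpace C] [ChartedSpace F C] (g : M → C) (m : M) : E →L[ℝ] F :=
  mfderiv 𝓘(ℝ, E) 𝓘(ℝ, F) g m

theorem tmap_comp {h : C → N} {g : M → C} {m : M}
    (hh : MDifferentiableAt 𝓘(ℝ, F) 𝓘(ℝ, G) h (g m))
    (hg : MDifferentiableAt 𝓘(ℝ, E) 𝓘(ℝ, F) g m) :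
    tmap E G (h ∘ g) m = (tmap F G h (g m)).comp (tmap E F g m) :=
  mfderiv_comp m hh hg

theorem tmap_congr {g g' : M → C} {m : M} (h : g =ᶠ[𝓝 m] g') :
    tmap E F g m = tmap E F g' m :=
  h.mfderiv_eq

theorem tmap_eq_fderiv (f : E → F) (y : E) : tmap E F f y = fderiv ℝ f y :=
  mfderiv_eq_fderiv

theorem tmap_id (m : M) : tmap E E (id : M → M) m = ContinuousLinearMap.id ℝ E :=
  mfderiv_id

theorem target_mem_nhds {x₀ : M} {y : E} (hy : y ∈ (extChartAt 𝓘(ℝ, E) x₀).target) :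
    (extChartAt 𝓘(ℝ, E) x₀).target ∈ 𝓝 y :=
  (isOpen_extChartAt_target x₀).mem_nhds hy

/-- The expression `ψ ∘ g ∘ φ⁻¹` of a map in the preferred charts around `x₀` and `c₀`. -/
def rep (E : Type*) [NormedAddCommGroup E] [NormedSpace ℝ E] {M : Type*} [TopologicalSpace M]
    [ChartedSpace E M] (F : Type*) [NormedAddCommGroup F] [NormedSpace ℝ F] {C : Type*}
    [TopologicalSpace C] [ChartedSpace F C] (g : M → C) (x₀ : M) (c₀ : C) : E → F :=
  extChartAt 𝓘(ℝ, F) c₀ ∘ g ∘ (extChartAt 𝓘(ℝ, E) x₀).symm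

/-- The value of a vector field at a point, as a vector of the model space. -/
def VField.val (X : VField E M) (m : M) : E := X m

theorem inChart_vfield_eq (X : VField E M) (x₀ : M) (y : E) :
    X.inChart x₀ y = tmap E E (extChartAt 𝓘(ℝ, E) x₀)
      ((extChartAt 𝓘(ℝ, E) x₀).symm y) (X.val ((extChartAt 𝓘(ℝ, E) x₀).symm y)) := rfl

/-- The value of a form at a point, as an alternating map on the model space. -/
def DForm.val {k : ℕ} (α : DForm E M k) (m : M) : E [⋀^Fin k]→L[ℝ] ℝ := α m

theorem inChart_form_eq {k : ℕ} (α : DForm E M k) (x₀ : M) (y : E) :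
    α.inChart x₀ y = (α.val ((extChartAt 𝓘(ℝ, E) x₀).symm y)).compContinuousLinearMap
      (tmap E E (extChartAt 𝓘(ℝ, E) x₀).symm y) := rfl

variable [IsManifold 𝓘(ℝ, E) ∞ M] [IsManifold 𝓘(ℝ, F) ∞ C]

theorem contMDiffAt_symm {x₀ : M} {y : E} (hy : y ∈ (extChartAt 𝓘(ℝ, E) x₀).target) :
    ContMDiffAt 𝓘(ℝ, E) 𝓘(ℝ, E) ∞ (extChartAt 𝓘(ℝ, E) x₀).symm y :=
  (contMDiffOn_extChartAt_symm x₀).contMDiffAt (target_mem_nhds hy)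

theorem contMDiffAt_chart {x₀ m : M} (hm : m ∈ (extChartAt 𝓘(ℝ, E) x₀).source) :
    ContMDiffAt 𝓘(ℝ, E) 𝓘(ℝ, E) ∞ (extChartAt 𝓘(ℝ, E) x₀) m :=
  contMDiffAt_extChartAt' (by simpa using hm)

theorem tmap_chart_comp_symm {x₀ : M} {y : E} (hy : y ∈ (extChartAt 𝓘(ℝ, E) x₀).target) :
    (tmap E E (extChartAt 𝓘(ℝ, E) x₀) ((extChartAt 𝓘(ℝ, E) x₀).symm y)).comp
      (tmap E E (extChartAt 𝓘(ℝ, E) x₀).symm y) = ContinuousLinearMap.id ℝ E := by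
  rw [← tmap_comp
    ((contMDiffAt_chart ((extChartAt 𝓘(ℝ, E) x₀).map_target hy)).mdifferentiableAt ne_zero_inf)
    ((contMDiffAt_symm hy).mdifferentiableAt ne_zero_inf), ← tmap_id (M := E) y]
  refine tmap_congr ?_
  filter_upwards [target_mem_nhds hy] with z hz
  exact (extChartAt 𝓘(ℝ, E) x₀).right_inv hz

theorem tmap_symm_comp_chart {x₀ : M} {y : E} (hy : y ∈ (extChartAt 𝓘(ℝ, E) x₀).target) :
    (tmap E E (extChartAt 𝓘(ℝ, E) x₀).symm y).comp
    (tmap E E (extChartAt 𝓘(ℝ, E) x₀) ((extChartAt 𝓘(ℝ, E) x₀).symm y))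
       = ContinuousLinearMap.id ℝ E := by
  set φ := extChartAt 𝓘(ℝ, E) x₀
  have hm := φ.map_target hy
  have h1 : MDifferentiableAt 𝓘(ℝ, E) 𝓘(ℝ, E) φ.symm (φ (φ.symm y)) := by
    rw [φ.right_inv hy]; exact (contMDiffAt_symm hy).mdifferentiableAt ne_zero_inf
  have h := tmap_comp h1 ((contMDiffAt_chart hm).mdifferentiableAt ne_zero_inf)
  rw [φ.right_inv hy] at h
  rw [← h, ← tmap_id (φ.symm y)]
  refine tmap_congr ?_
  filter_upwards [extChartAt_source_mem_nhds' (I := 𝓘(ℝ, E)) hm] with z hz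
  exact φ.left_inv hz

theorem tmap_chart_symm_apply {x₀ : M} {y : E} (hy : y ∈ (extChartAt 𝓘(ℝ, E) x₀).target) (v : E) :
    tmap E E (extChartAt 𝓘(ℝ, E) x₀) ((extChartAt 𝓘(ℝ, E) x₀).symm y)
      (tmap E E (extChartAt 𝓘(ℝ, E) x₀).symm y v) = v :=
  DFunLike.congr_fun (tmap_chart_comp_symm hy) v

theorem tmap_symm_chart_apply {x₀ : M} {y : E} (hy : y ∈ (extChartAt 𝓘(ℝ, E) x₀).target) (v : E) :
    (tmap E E (extChartAt 𝓘(ℝ, E) x₀).symm y)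
    (tmap E E (extChartAt 𝓘(ℝ, E) x₀) ((extChartAt 𝓘(ℝ, E) x₀).symm y) v) = v :=
  DFunLike.congr_fun (tmap_symm_comp_chart hy) v

theorem tmap_chart_self (x : M) :
    tmap E E (extChartAt 𝓘(ℝ, E) x) x = ContinuousLinearMap.id ℝ E :=
  have := IsManifold.of_le (I := 𝓘(ℝ, E)) (M := M) (m := 1) (n := ∞) (by simp)
  mfderiv_extChartAt_self

theorem tmap_symm_self (x : M) :
    tmap E E (extChartAt 𝓘(ℝ, E) x).symm (extChartAt 𝓘(ℝ, E) x x) =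
      ContinuousLinearMap.id ℝ E := by
  have h := tmap_chart_comp_symm (mem_extChartAt_target (I := 𝓘(ℝ, E)) x)
  rwa [extChartAt_to_inv, tmap_chart_self, ContinuousLinearMap.id_comp] at h

variable {g : M → C} {x₀ : M} {c₀ : C} {y : E}

theorem contDiffAt_rep (hy : y ∈ (extChartAt 𝓘(ℝ, E) x₀).target)
    (hg : ContMDiffAt 𝓘(ℝ, E) 𝓘(ℝ, F) ∞ g ((extChartAt 𝓘(ℝ, E) x₀).symm y))
    (hc : g ((extChartAt 𝓘(ℝ, E) x₀).symm y) ∈ (extChartAt 𝓘(ℝ, F) c₀).source) :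
    ContDiffAt ℝ ∞ (rep E F g x₀ c₀) y := by
  rw [← contMDiffAt_iff_contDiffAt]
  exact ContMDiffAt.comp y (contMDiffAt_chart hc) (hg.comp y (contMDiffAt_symm hy))

theorem fderiv_rep (hy : y ∈ (extChartAt 𝓘(ℝ, E) x₀).target)
    (hg : MDifferentiableAt 𝓘(ℝ, E) 𝓘(ℝ, F) g ((extChartAt 𝓘(ℝ, E) x₀).symm y))
    (hc : g ((extChartAt 𝓘(ℝ, E) x₀).symm y) ∈ (extChartAt 𝓘(ℝ, F) c₀).source) :
    fderiv ℝ (rep E F g x₀ c₀) y =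
      (tmap F F (extChartAt 𝓘(ℝ, F) c₀) (g ((extChartAt 𝓘(ℝ, E) x₀).symm y))).comp
        ((tmap E F g ((extChartAt 𝓘(ℝ, E) x₀).symm y)).comp
          (tmap E E (extChartAt 𝓘(ℝ, E) x₀).symm y)) := by
  have h1 := (contMDiffAt_symm hy).mdifferentiableAt ne_zero_inf
  rw [← tmap_eq_fderiv, ← tmap_comp hg h1]
  exact tmap_comp ((contMDiffAt_chart hc).mdifferentiableAt ne_zero_inf) (hg.comp y h1)

theorem inChart_vfield_self (X : VField E M) (x : M) :
    X.inChart x (extChartAt 𝓘(ℝ, E) x x) = X.val x := by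
  rw [inChart_vfield_eq, extChartAt_to_inv, tmap_chart_self]; rfl

theorem tmap_symm_inChart (X : VField E M) (hy : y ∈ (extChartAt 𝓘(ℝ, E) x₀).target) :
    tmap E E (extChartAt 𝓘(ℝ, E) x₀).symm y (X.inChart x₀ y) =
      X.val ((extChartAt 𝓘(ℝ, E) x₀).symm y) :=
  tmap_symm_chart_apply hy _

theorem fderiv_rep_inChart (X : VField E M) (hy : y ∈ (extChartAt 𝓘(ℝ, E) x₀).target)
    (hg : MDifferentiableAt 𝓘(ℝ, E) 𝓘(ℝ, F) g ((extChartAt 𝓘(ℝ, E) x₀).symm y))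
    (hc : g ((extChartAt 𝓘(ℝ, E) x₀).symm y) ∈ (extChartAt 𝓘(ℝ, F) c₀).source) :
    fderiv ℝ (rep E F g x₀ c₀) y (X.inChart x₀ y) =
      tmap F F (extChartAt 𝓘(ℝ, F) c₀) (g ((extChartAt 𝓘(ℝ, E) x₀).symm y))
        (tmap E F g ((extChartAt 𝓘(ℝ, E) x₀).symm y) (X.val ((extChartAt 𝓘(ℝ, E) x₀).symm y))) := by
  rw [fderiv_rep hy hg hc]
  simp only [ContinuousLinearMap.comp_apply]
  rw [tmap_symm_inChart X hy]

theorem inChart_form_self {k : ℕ} (α : DForm E M k) (x : M) :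
    α.inChart x (extChartAt 𝓘(ℝ, E) x x) = α.val x := by
  rw [inChart_form_eq, extChartAt_to_inv, tmap_symm_self]
  rfl

theorem inChart_pullback {k : ℕ} (α : DForm F C k) (hy : y ∈ (extChartAt 𝓘(ℝ, E) x₀).target)
    (hg : MDifferentiableAt 𝓘(ℝ, E) 𝓘(ℝ, F) g ((extChartAt 𝓘(ℝ, E) x₀).symm y))
    (hc : g ((extChartAt 𝓘(ℝ, E) x₀).symm y) ∈ (extChartAt 𝓘(ℝ, F) c₀).source) :
    (α.pullback g).inChart x₀ y =
      (α.inChart c₀ (rep E F g x₀ c₀ y)).compContinuousLinearMap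
        (fderiv ℝ (rep E F g x₀ c₀) y) := by
  set m := (extChartAt 𝓘(ℝ, E) x₀).symm y with hm
  have h1 : (extChartAt 𝓘(ℝ, F) c₀).symm (rep E F g x₀ c₀ y) = g m :=
    (extChartAt 𝓘(ℝ, F) c₀).left_inv hc
  have ht : rep E F g x₀ c₀ y ∈ (extChartAt 𝓘(ℝ, F) c₀).target :=
    (extChartAt 𝓘(ℝ, F) c₀).map_source hc
  have h2 := tmap_symm_comp_chart ht
  rw [h1] at h2
  rw [inChart_form_eq, inChart_form_eq, h1, fderiv_rep hy hg hc]
  ext v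
  change α.val (g m) _ = α.val (g m) _
  congr 1
  funext i
  exact (DFunLike.congr_fun h2 (tmap E F g m (tmap E E (extChartAt 𝓘(ℝ, E) x₀).symm y (v i)))).symm

theorem inChart_interior {k : ℕ} (X : VField E M) (α : DForm E M (k + 1))
    (hy : y ∈ (extChartAt 𝓘(ℝ, E) x₀).target) :
    (α.interior X).inChart x₀ y = (α.inChart x₀ y).curryLeft (X.inChart x₀ y) := by
  ext v
  have h := tmap_symm_inChart X hy
  set m := (extChartAt 𝓘(ℝ, E) x₀).symm y with hm
  change α.val m (Matrix.vecCons (X.val m) fun i => tmap E E (extChartAt 𝓘(ℝ, E) x₀).symm y (v i)) =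
    α.val m (fun i => tmap E E (extChartAt 𝓘(ℝ, E) x₀).symm y (Matrix.vecCons (X.inChart x₀ y) v i))
  congr 1
  funext i
  refine Fin.cases ?_ (fun i => ?_) i
  · exact h.symm
  · rfl

end ChartCalculus

/-! ### Calculus of forms on a vector space -/

section VectorSpaceCalculus

variable {E : Type*} [NormedAddCommGroup E] [NormedSpace ℝ E]
  {F : Type*} [NormedAddCommGroup F] [NormedSpace ℝ F]

theorem fderiv_alternating_one {β : E → E [⋀^Fin 1]→L[ℝ] ℝ} {a : E → E} {y : E}
    (hβ : DifferentiableAt ℝ β y) (ha : DifferentiableAt ℝ a y) (u : E) :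
    fderiv ℝ (fun y => β y ![a y]) y u = fderiv ℝ β y u ![a y] + β y ![fderiv ℝ a y u] := by
  have h := fderiv_continuousAlternatingMap_apply_apply (g := ![a]) hβ
    (fun i => by fin_cases i; exact ha) u
  have e : ∀ y, (fun i => (![a] : Fin 1 → E → E) i y) = ![a y] := fun y => by
    ext i; fin_cases i; rfl
  simp only [e] at h
  rw [h, Fin.sum_univ_one]
  congr 2
  ext i; fin_cases i; rfl

theorem fderiv_alternating_two {W : E → E [⋀^Fin 2]→L[ℝ] ℝ} {a b : E → E} {y : E}
    (hW : DifferentiableAt ℝ W y) (ha : DifferentiableAt ℝ a y) (hb : DifferentiableAt ℝ b y)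
    (u : E) :
    fderiv ℝ (fun y => W y ![a y, b y]) y u =
      fderiv ℝ W y u ![a y, b y] + W y ![fderiv ℝ a y u, b y] + W y ![a y, fderiv ℝ b y u] := by
  have h := fderiv_continuousAlternatingMap_apply_apply (g := ![a, b]) hW
    (fun i => by fin_cases i; exacts [ha, hb]) u
  have e : ∀ y, (fun i => (![a, b] : Fin 2 → E → E) i y) = ![a y, b y] := fun y => by
    ext i; fin_cases i <;> rfl
  simp only [e] at h
  rw [h, Fin.sum_univ_two, add_assoc]
  congr 3 <;> · ext i; fin_cases i <;> rfl

theorem extDeriv_one_form {β : E → E [⋀^Fin 1]→L[ℝ] ℝ} {y : E}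
    (u v : E) : extDeriv β y ![u, v] = fderiv ℝ β y u ![v] - fderiv ℝ β y v ![u] := by
  rw [extDeriv, ContinuousAlternatingMap.alternatizeUncurryFin_apply, Fin.sum_univ_two]
  have e0 : Fin.removeNth 0 ![u, v] = ![v] := by ext i; fin_cases i; rfl
  have e1 : Fin.removeNth 1 ![u, v] = ![u] := by ext i; fin_cases i; rfl
  rw [e0, e1]
  simp [sub_eq_add_neg]

theorem extDeriv_two_form {W : E → E [⋀^Fin 2]→L[ℝ] ℝ} {y : E}
    (u v w : E) : extDeriv W y ![u, v, w] =
      fderiv ℝ W y u ![v, w] - fderiv ℝ W y v ![u, w] + fderiv ℝ W y w ![u, v] := by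
  rw [extDeriv, ContinuousAlternatingMap.alternatizeUncurryFin_apply, Fin.sum_univ_three]
  have e0 : Fin.removeNth 0 ![u, v, w] = ![v, w] := by ext i; fin_cases i <;> rfl
  have e1 : Fin.removeNth 1 ![u, v, w] = ![u, w] := by ext i; fin_cases i <;> rfl
  have e2 : Fin.removeNth 2 ![u, v, w] = ![u, v] := by ext i; fin_cases i <;> rfl
  rw [e0, e1, e2]
  simp [sub_eq_add_neg]

/-- One-forms as linear functionals. -/
def oneFormEquiv : (E [⋀^Fin 1]→L[ℝ] ℝ) ≃ₗᵢ[ℝ] (E →L[ℝ] ℝ) :=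
  (ContinuousAlternatingMap.ofSubsingletonLIE (𝕜 := ℝ) (E := E) (F := ℝ) (0 : Fin 1)).symm

theorem oneFormEquiv_apply (b : E [⋀^Fin 1]→L[ℝ] ℝ) (v : E) : oneFormEquiv b v = b ![v] := by
  change b (fun _ => v) = _
  congr 1
  ext i; fin_cases i; rfl

theorem contDiff_curryLeft (n : ℕ) :
    ContDiff ℝ ∞ (fun a : E [⋀^Fin (n + 1)]→L[ℝ] ℝ => a.curryLeft) := by
  let c : (E [⋀^Fin (n + 1)]→L[ℝ] ℝ) →L[ℝ] (E →L[ℝ] E [⋀^Fin n]→L[ℝ] ℝ) :=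
    ContinuousAlternatingMap.curryLeftLI.toContinuousLinearMap
  have : ContDiff ℝ ∞ ⇑c := by fun_prop
  exact this

section AlternatingTwo

variable (a : E [⋀^Fin 2]→L[ℝ] ℝ)

theorem alternating_two_swap (u v : E) : a ![u, v] = -a ![v, u] := by
  have h := a.map_swap ![u, v] (i := 0) (j := 1) (by decide)
  have e : (![u, v] ∘ (Equiv.swap (0 : Fin 2) 1) : Fin 2 → E) = ![v, u] := by
    ext i; fin_cases i <;> simp
  rw [e] at h
  change a ![v, u] = -a ![u, v] at h
  linarith

theorem alternating_two_self (u : E) : a ![u, u] = 0 := by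
  linarith [alternating_two_swap a u u]

theorem alternating_two_sub_left (u u' v : E) : a ![u - u', v] = a ![u, v] - a ![u', v] := by
  have h := a.map_vecCons_add ![v] (u - u') u'
  rw [sub_add_cancel] at h
  change a ![u, v] = a ![u - u', v] + a ![u', v] at h
  linarith

end AlternatingTwo

/-- Differentiating `W(X, ·) = -dH` along `d`, and inserting `L_d W = W` and the derivative of
`dH(d) = H`, all second derivatives of `H` cancel and `W([d, X], ·) = 0` remains. -/
theorem fderiv_comm_of_scaling {W : E → E [⋀^Fin 2]→L[ℝ] ℝ} {d X : E → E} {H : E → ℝ} {y₀ : E}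
    (hW : DifferentiableAt ℝ W y₀) (hd : DifferentiableAt ℝ d y₀) (hX : DifferentiableAt ℝ X y₀)
    (hH : ContDiffAt ℝ ∞ H y₀)
    (hnd : ∀ u, (∀ v, W y₀ ![u, v] = 0) → u = 0)
    (hham : ∀ᶠ y in 𝓝 y₀, ∀ v, W y ![X y, v] = -fderiv ℝ H y v)
    (hdH : ∀ᶠ y in 𝓝 y₀, fderiv ℝ H y (d y) = H y)
    (hL : ∀ u v, fderiv ℝ W y₀ (d y₀) ![u, v] + W y₀ ![fderiv ℝ d y₀ u, v] +
      W y₀ ![u, fderiv ℝ d y₀ v] = W y₀ ![u, v]) :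
    fderiv ℝ X y₀ (d y₀) = fderiv ℝ d y₀ (X y₀) := by
  have hH' : DifferentiableAt ℝ (fderiv ℝ H) y₀ :=
    (hH.fderiv_right (m := 1) (by norm_cast)).differentiableAt (by simp)
  have hsymm : IsSymmSndFDerivAt ℝ H y₀ := hH.isSymmSndFDerivAt (by simp; norm_cast)
  refine sub_eq_zero.1 (hnd _ fun v => ?_)
  rw [alternating_two_sub_left]
  -- Hamilton's equation `W(X, v) = -dH(v)`, differentiated along `d`
  have h1 : fderiv ℝ (fun y => W y ![X y, v]) y₀ (d y₀) =
      fderiv ℝ (fun y => -fderiv ℝ H y v) y₀ (d y₀) := by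
    rw [Filter.EventuallyEq.fderiv_eq (hham.mono fun y hy => hy v)]
  rw [fderiv_alternating_two hW hX (differentiableAt_const v), fderiv_fun_neg,
    fderiv_clm_apply hH' (differentiableAt_const v)] at h1
  -- the scaling law `dH(d) = H`, differentiated along `v`
  have h2 : fderiv ℝ (fun y => fderiv ℝ H y (d y)) y₀ v = fderiv ℝ H y₀ v := by
    rw [Filter.EventuallyEq.fderiv_eq hdH]
  rw [fderiv_clm_apply hH' hd] at h2
  -- the scaling law `L_d W = W`, evaluated on `X` and `v`
  have h3 := hL (X y₀) v
  have h4 := hham.self_of_nhds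
  rw [h4 v, h4] at h3
  have e0 : W y₀ ![X y₀, 0] = 0 := (W y₀).map_coord_zero 1 rfl
  simp [e0] at h1 h2
  have h5 := hsymm.eq (d y₀) v
  linarith

/-- The product rule for `r β = W(d, ·)`. -/
theorem fderiv_scaled_interior {W : E → E [⋀^Fin 2]→L[ℝ] ℝ} {d : E → E}
    {β : E → E [⋀^Fin 1]→L[ℝ] ℝ} {r : E → ℝ} {y₀ : E}
    (hW : DifferentiableAt ℝ W y₀) (hd : DifferentiableAt ℝ d y₀) (hβ : DifferentiableAt ℝ β y₀)
    (hr : DifferentiableAt ℝ r y₀)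
    (hrβ : ∀ᶠ y in 𝓝 y₀, ∀ v, r y * β y ![v] = W y ![d y, v]) (u v : E) :
    fderiv ℝ r y₀ u * β y₀ ![v] + r y₀ * fderiv ℝ β y₀ u ![v] =
      fderiv ℝ W y₀ u ![d y₀, v] + W y₀ ![fderiv ℝ d y₀ u, v] := by
  have h1 : fderiv ℝ (fun y => r y * β y ![v]) y₀ u = fderiv ℝ (fun y => W y ![d y, v]) y₀ u := by
    rw [Filter.EventuallyEq.fderiv_eq (hrβ.mono fun y hy => hy v)]
  have hβv : DifferentiableAt ℝ (fun y => β y ![v]) y₀ :=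
    hβ.continuousAlternatingMap_apply (g := fun i _ => ![v] i) fun i => differentiableAt_const _
  have h2 := fderiv_alternating_one hβ (differentiableAt_const v) u
  rw [fderiv_alternating_two hW hd (differentiableAt_const v), fderiv_fun_mul hr hβv] at h1
  have e0 : W y₀ ![d y₀, 0] = 0 := (W y₀).map_coord_zero 1 rfl
  have e1 : β y₀ ![0] = 0 := (β y₀).map_coord_zero 0 rfl
  simp [e1] at h2
  simp [e0, h2] at h1
  linarith

/-- If `L_d W = W` and `dr(d) = r`, then `β = W(d, ·) / r` is invariant along `d`. -/
theorem lieDeriv_scaled_interior {W : E → E [⋀^Fin 2]→L[ℝ] ℝ} {d : E → E}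
    {β : E → E [⋀^Fin 1]→L[ℝ] ℝ} {r : E → ℝ} {y₀ : E}
    (hW : DifferentiableAt ℝ W y₀) (hd : DifferentiableAt ℝ d y₀) (hβ : DifferentiableAt ℝ β y₀)
    (hr : DifferentiableAt ℝ r y₀) (hr0 : r y₀ ≠ 0) (hdr : fderiv ℝ r y₀ (d y₀) = r y₀)
    (hrβ : ∀ᶠ y in 𝓝 y₀, ∀ v, r y * β y ![v] = W y ![d y, v])
    (hL : ∀ u v, fderiv ℝ W y₀ (d y₀) ![u, v] + W y₀ ![fderiv ℝ d y₀ u, v] +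
      W y₀ ![u, fderiv ℝ d y₀ v] = W y₀ ![u, v]) (v : E) :
    fderiv ℝ β y₀ (d y₀) ![v] + β y₀ ![fderiv ℝ d y₀ v] = 0 := by
  have h1 := fderiv_scaled_interior hW hd hβ hr hrβ (d y₀) v
  have h2 := hL (d y₀) v
  rw [← hrβ.self_of_nhds, ← hrβ.self_of_nhds] at h2
  rw [hdr] at h1
  refine (mul_eq_zero.1 (?_ : r y₀ * _ = 0)).resolve_left hr0
  linarith

/-- `r dβ = W - dr ∧ β` for `β = W(d, ·) / r`, with `W` closed and `L_d W = W`: since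
`d(i_d W) = L_d W = W`. -/
theorem extDeriv_scaled_interior {W : E → E [⋀^Fin 2]→L[ℝ] ℝ} {d : E → E}
    {β : E → E [⋀^Fin 1]→L[ℝ] ℝ} {r : E → ℝ} {y₀ : E}
    (hW : DifferentiableAt ℝ W y₀) (hd : DifferentiableAt ℝ d y₀) (hβ : DifferentiableAt ℝ β y₀)
    (hr : DifferentiableAt ℝ r y₀)
    (hrβ : ∀ᶠ y in 𝓝 y₀, ∀ v, r y * β y ![v] = W y ![d y, v])
    (hL : ∀ u v, fderiv ℝ W y₀ (d y₀) ![u, v] + W y₀ ![fderiv ℝ d y₀ u, v] +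
      W y₀ ![u, fderiv ℝ d y₀ v] = W y₀ ![u, v])
    (hclosed : extDeriv W y₀ = 0) (u v : E) :
    r y₀ * extDeriv β y₀ ![u, v] =
      W y₀ ![u, v] - (fderiv ℝ r y₀ u * β y₀ ![v] - fderiv ℝ r y₀ v * β y₀ ![u]) := by
  have h1 := fderiv_scaled_interior hW hd hβ hr hrβ u v
  have h2 := fderiv_scaled_interior hW hd hβ hr hrβ v u
  have h3 := hL u v
  have h4 := extDeriv_two_form (W := W) (y := y₀) (d y₀) u v
  rw [hclosed] at h4
  have h5 := alternating_two_swap (W y₀) u (fderiv ℝ d y₀ v)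
  simp at h4
  rw [extDeriv_one_form]
  linarith

/-- The projection of a field commuting with `d` has zero derivative along `d` when `d` projects
to zero. -/
theorem fderiv_proj_eq_zero {f : E → F} {d X : E → E} {y₀ : E} (hf : ContDiffAt ℝ ∞ f y₀)
    (hd : DifferentiableAt ℝ d y₀) (hX : DifferentiableAt ℝ X y₀)
    (hfd : ∀ᶠ y in 𝓝 y₀, fderiv ℝ f y (d y) = 0)
    (hcomm : fderiv ℝ X y₀ (d y₀) = fderiv ℝ d y₀ (X y₀)) :
    fderiv ℝ (fun y => fderiv ℝ f y (X y)) y₀ (d y₀) = 0 := by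
  have hf' : DifferentiableAt ℝ (fderiv ℝ f) y₀ :=
    (hf.fderiv_right (m := 1) (by norm_cast)).differentiableAt (by simp)
  have hsymm : IsSymmSndFDerivAt ℝ f y₀ := hf.isSymmSndFDerivAt (by simp; norm_cast)
  have h2 : fderiv ℝ (fun y => fderiv ℝ f y (d y)) y₀ (X y₀) = 0 := by
    rw [Filter.EventuallyEq.fderiv_eq (f := fun _ => (0 : F)) hfd]; simp
  rw [fderiv_clm_apply hf' hd] at h2
  rw [fderiv_clm_apply hf' hX]
  simp only [add_apply, ContinuousLinearMap.comp_apply,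
    ContinuousLinearMap.flip_apply] at h2 ⊢
  rw [hcomm, hsymm.eq, h2]

/-- If `β = e ∘ df` is invariant along `d` and `d` projects to zero, then `e` is constant
along `d` to first order. -/
theorem fderiv_coeff_eq_zero {f : E → F} {d : E → E} {β : E → E [⋀^Fin 1]→L[ℝ] ℝ}
    {e : E → F →L[ℝ] ℝ} {y₀ : E} (hf : ContDiffAt ℝ ∞ f y₀)
    (hd : DifferentiableAt ℝ d y₀) (hβ : DifferentiableAt ℝ β y₀) (he : DifferentiableAt ℝ e y₀)
    (hfd : ∀ᶠ y in 𝓝 y₀, fderiv ℝ f y (d y) = 0)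
    (hβe : ∀ᶠ y in 𝓝 y₀, ∀ v, β y ![v] = e y (fderiv ℝ f y v))
    (hL : ∀ v, fderiv ℝ β y₀ (d y₀) ![v] + β y₀ ![fderiv ℝ d y₀ v] = 0)
    (hsurj : Function.Surjective (fderiv ℝ f y₀)) :
    fderiv ℝ e y₀ (d y₀) = 0 := by
  have hf' : DifferentiableAt ℝ (fderiv ℝ f) y₀ :=
    (hf.fderiv_right (m := 1) (by norm_cast)).differentiableAt (by simp)
  have hsymm : IsSymmSndFDerivAt ℝ f y₀ := hf.isSymmSndFDerivAt (by simp; norm_cast)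
  ext w
  obtain ⟨v, rfl⟩ := hsurj w
  have h1 : fderiv ℝ (fun y => β y ![v]) y₀ (d y₀) =
      fderiv ℝ (fun y => e y (fderiv ℝ f y v)) y₀ (d y₀) := by
    rw [Filter.EventuallyEq.fderiv_eq (hβe.mono fun y hy => hy v)]
  rw [fderiv_alternating_one hβ (differentiableAt_const v),
    fderiv_clm_apply he (hf'.clm_apply (differentiableAt_const v)),
    fderiv_clm_apply hf' (differentiableAt_const v)] at h1
  have h2 : fderiv ℝ (fun y => fderiv ℝ f y (d y)) y₀ v = 0 := by
    rw [Filter.EventuallyEq.fderiv_eq (f := fun _ => (0 : F)) hfd]; simp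
  rw [fderiv_clm_apply hf' hd] at h2
  have h3 := hL v
  rw [hβe.self_of_nhds] at h3
  have e0 : β y₀ ![0] = 0 := (β y₀).map_coord_zero 0 rfl
  simp [e0] at h1 h2 ⊢
  have h5 := hsymm.eq (d y₀) v
  rw [← h5] at h2
  have h6 := congrArg (e y₀) h2
  rw [map_add, map_zero] at h6
  linarith

/-- The coefficient `e` in `β = e ∘ df` is differentiable: `e = β ∘ S` for the right inverse
`S = S₀ ∘ (df ∘ S₀)⁻¹` of `df`. -/
theorem differentiableAt_coeff [FiniteDimensional ℝ F] {f : E → F}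
    {β : E → E [⋀^Fin 1]→L[ℝ] ℝ}
    {e : E → F →L[ℝ] ℝ} {y₀ : E} (hf : ContDiffAt ℝ ∞ f y₀)
    (hβ : DifferentiableAt ℝ β y₀)
    (hβe : ∀ᶠ y in 𝓝 y₀, ∀ v, β y ![v] = e y (fderiv ℝ f y v))
    (hsurj : Function.Surjective (fderiv ℝ f y₀)) :
    DifferentiableAt ℝ e y₀ := by
  have := FiniteDimensional.complete ℝ F
  have hf' : DifferentiableAt ℝ (fderiv ℝ f) y₀ :=
    (hf.fderiv_right (m := 1) (by norm_cast)).differentiableAt (by simp)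
  obtain ⟨S, hS⟩ := (fderiv ℝ f y₀).toLinearMap.exists_rightInverse_of_surjective
    (LinearMap.range_eq_top.2 hsurj)
  let S₀ : F →L[ℝ] E := LinearMap.toContinuousLinearMap S
  let T : E → F →L[ℝ] F := fun y => (fderiv ℝ f y).comp S₀
  have hT0 : T y₀ = 1 := by
    ext w; exact LinearMap.congr_fun hS w
  have hT : DifferentiableAt ℝ T y₀ := hf'.clm_comp (differentiableAt_const S₀)
  have hinv : DifferentiableAt ℝ (fun y => Ring.inverse (T y)) y₀ :=
    hT.inverse (by rw [hT0]; exact isUnit_one)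
  have hunit : ∀ᶠ y in 𝓝 y₀, IsUnit (T y) := by
    refine hT.continuousAt.eventually_mem (s := {x | IsUnit x}) ?_
    rw [hT0]; exact Units.isOpen.mem_nhds isUnit_one
  have hmain : DifferentiableAt ℝ
      (fun y => (oneFormEquiv (β y)).comp (S₀.comp (Ring.inverse (T y)))) y₀ :=
    ((oneFormEquiv (E := E)).toContinuousLinearEquiv.differentiableAt.comp y₀ hβ).clm_comp
      ((differentiableAt_const S₀).clm_comp hinv)
  refine hmain.congr_of_eventuallyEq ?_
  filter_upwards [hβe, hunit] with y hy hu
  ext w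
  change _ = oneFormEquiv (β y) (S₀ (Ring.inverse (T y) w))
  rw [oneFormEquiv_apply, hy]
  congr 1
  have := DFunLike.congr_fun (Ring.mul_inverse_cancel _ hu) w
  exact this.symm

/-- A solution `X` of `W(X, ·) = -dH` with `W` non-degenerate is as smooth as the data. -/
theorem contDiffAt_of_hamiltonian [FiniteDimensional ℝ E] {W : E → E [⋀^Fin 2]→L[ℝ] ℝ}
    {X : E → E} {H : E → ℝ} {y₀ : E} (hW : ContDiffAt ℝ ∞ W y₀) (hH : ContDiffAt ℝ ∞ H y₀)
    (hnd : ∀ u, (∀ v, W y₀ ![u, v] = 0) → u = 0)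
    (hham : ∀ᶠ y in 𝓝 y₀, ∀ v, W y ![X y, v] = -fderiv ℝ H y v) :
    ContDiffAt ℝ ∞ X y₀ := by
  have := FiniteDimensional.complete ℝ E
  let J : E → E →L[ℝ] E →L[ℝ] ℝ := fun y =>
    (oneFormEquiv (E := E)).toContinuousLinearEquiv.toContinuousLinearMap.comp  (W y).curryLeft
  have hJ : ∀ y u v, J y u v = W y ![u, v] := by
    intro y u v
    exact oneFormEquiv_apply _ v
  have hJs : ContDiffAt ℝ ∞ J y₀ :=
    contDiffAt_const.clm_comp ((contDiff_curryLeft (E := E) 1).contDiffAt.comp y₀ hW)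
  have hinj : Function.Injective (J y₀) := by
    refine (injective_iff_map_eq_zero (J y₀)).2 fun u hu => hnd u fun v => ?_
    rw [← hJ, hu]; rfl
  have hfr : Module.finrank ℝ E = Module.finrank ℝ (E →L[ℝ] ℝ) := by
    rw [← (LinearMap.toContinuousLinearMap (𝕜 := ℝ) (E := E) (F' := ℝ)).finrank_eq]
    exact (Subspace.dual_finrank_eq (K := ℝ) (V := E)).symm
  let e₀ : E ≃L[ℝ] (E →L[ℝ] ℝ) :=
    (LinearEquiv.ofInjectiveOfFinrankEq (J y₀).toLinearMap hinj hfr).toContinuousLinearEquiv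
  have he₀ : (e₀ : E →L[ℝ] (E →L[ℝ] ℝ)) = J y₀ := by ext u v; rfl
  have hinv : ContDiffAt ℝ ∞ (fun y => (J y).inverse) y₀ := by
    have h : ContDiffAt ℝ ∞ (ContinuousLinearMap.inverse :
        (E →L[ℝ] (E →L[ℝ] ℝ)) → (E →L[ℝ] ℝ) →L[ℝ] E) (e₀ : E →L[ℝ] (E →L[ℝ] ℝ)) :=
      contDiffAt_map_inverse e₀
    rw [he₀] at h
    exact h.comp y₀ hJs
  have hopen : ∀ᶠ y in 𝓝 y₀, (J y).IsInvertible := by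
    refine hJs.continuousAt.eventually_mem (s := {x | x.IsInvertible}) ?_
    rw [← he₀]
    exact ContinuousLinearEquiv.nhds e₀
  refine (hinv.clm_apply ((hH.fderiv_right (m := ∞) (by norm_cast)).neg)).congr_of_eventuallyEq ?_
  filter_upwards [hham, hopen] with y hy hu
  have : J y (X y) = -fderiv ℝ H y := by
    ext v; rw [hJ, hy]; rfl
  change _ = (J y).inverse (-fderiv ℝ H y)
  rw [← this]
  obtain ⟨e, he⟩ := hu
  rw [← he]; simp

end VectorSpaceCalculus

/-! ### Integral curves, submersions and the fibers of the quotient -/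

section IntegralCurves

variable {E : Type*} [NormedAddCommGroup E] [NormedSpace ℝ E]
  {M : Type*} [TopologicalSpace M] [ChartedSpace E M]
  {F : Type*} [NormedAddCommGroup F] [NormedSpace ℝ F]
  {C : Type*} [TopologicalSpace C] [ChartedSpace F C]
  {V : Type*} [NormedAddCommGroup V] [NormedSpace ℝ V]

theorem hasMFDerivAt_of_curve {D : VField E M} {γ : ℝ → M} {s : Set ℝ} (hs : IsOpen s)
    (hγ : IsMIntegralCurveOn γ D s) {t : ℝ} (ht : t ∈ s) :
    HasMFDerivAt 𝓘(ℝ, ℝ) 𝓘(ℝ, E) γ t ((1 : ℝ →L[ℝ] ℝ).smulRight (D (γ t))) :=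
  (hγ t ht).hasMFDerivAt (hs.mem_nhds ht)

variable [IsManifold 𝓘(ℝ, E) ∞ M]

theorem hasDerivAt_chart_curve {D : VField E M} {γ : ℝ → M} {s : Set ℝ} (hs : IsOpen s)
    (hγ : IsMIntegralCurveOn γ D s) {t : ℝ} (ht : t ∈ s) :
    HasDerivAt (extChartAt 𝓘(ℝ, E) (γ t) ∘ γ) (D.val (γ t)) t := by
  have h1 := hasMFDerivAt_of_curve hs hγ ht
  have h2 : MDifferentiableAt 𝓘(ℝ, E) 𝓘(ℝ, E) (extChartAt 𝓘(ℝ, E) (γ t)) (γ t) :=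
    (contMDiffAt_chart (mem_extChartAt_source (γ t))).mdifferentiableAt ne_zero_inf
  have h3 := tmap_comp h2 h1.mdifferentiableAt
  rw [tmap_chart_self, tmap_eq_fderiv, ContinuousLinearMap.id_comp] at h3
  have h4 : tmap ℝ E γ t = (1 : ℝ →L[ℝ] ℝ).smulRight (D.val (γ t)) := h1.mfderiv
  rw [h4] at h3
  have h5 := (h2.comp t h1.mdifferentiableAt).differentiableAt.hasFDerivAt
  rw [h3] at h5
  have h6 := h5.hasDerivAt
  convert h6 using 1
  simp

/-- A function whose derivative along `D`, computed in charts, vanishes along an integral curve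
of `D` is constant on that curve. -/
theorem eq_on_curve {D : VField E M} {γ : ℝ → M} {s : Set ℝ} (hs : IsOpen s)
    (hs' : s.OrdConnected) (hγ : IsMIntegralCurveOn γ D s) {G : M → V}
    (hG : ∀ t ∈ s, DifferentiableAt ℝ (G ∘ (extChartAt 𝓘(ℝ, E) (γ t)).symm)
        (extChartAt 𝓘(ℝ, E) (γ t) (γ t)) ∧
      fderiv ℝ (G ∘ (extChartAt 𝓘(ℝ, E) (γ t)).symm) (extChartAt 𝓘(ℝ, E) (γ t) (γ t))
        (D.val (γ t)) = 0)
    {t t' : ℝ} (ht : t ∈ s) (ht' : t' ∈ s) : G (γ t) = G (γ t') := by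
  have key : ∀ t ∈ s, HasDerivAt (G ∘ γ) 0 t := by
    intro t ht
    have h1 := (hG t ht).1.hasFDerivAt.comp_hasDerivAt t (hasDerivAt_chart_curve hs hγ ht)
    rw [(hG t ht).2] at h1
    refine h1.congr_of_eventuallyEq ?_
    have hc := (hasMFDerivAt_of_curve hs hγ ht).continuousAt
    filter_upwards [hc.eventually_mem (extChartAt_source_mem_nhds (I := 𝓘(ℝ, E)) (γ t))] with r hr
    exact (congrArg G ((extChartAt 𝓘(ℝ, E) (γ t)).left_inv hr)).symm
  exact hs.is_const_of_deriv_eq_zero (f := G ∘ γ) hs'.isPreconnected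
    (fun t ht => (key t ht).differentiableAt.differentiableWithinAt)
    (fun t ht => (key t ht).deriv) ht ht'

end IntegralCurves

section Submersion

variable {E : Type*} [NormedAddCommGroup E] [NormedSpace ℝ E]
  {M : Type*} [TopologicalSpace M] [ChartedSpace E M]
  {F : Type*} [NormedAddCommGroup F] [NormedSpace ℝ F]
  {C : Type*} [TopologicalSpace C] [ChartedSpace F C]

/-- Submersions have smooth local sections through every point. -/
theorem exists_local_section {π : M → C} (hπ : Manifold.IsSubmersion 𝓘(ℝ, E) 𝓘(ℝ, F) ∞ π) (m : M) :
    ∃ (σ : C → M) (U : Set C), IsOpen U ∧ π m ∈ U ∧ σ (π m) = m ∧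
      (∀ c ∈ U, ContMDiffAt 𝓘(ℝ, F) 𝓘(ℝ, E) ∞ σ c) ∧ ∀ c ∈ U, π (σ c) = c := by
  obtain ⟨K, _, _, hK⟩ := hπ
  have h := hK m
  set φ := h.domChart
  set ψ := h.codChart
  have hφm := h.mem_domChart_source
  -- In submersion charts `π` is the projection `F × K → F`; the section keeps the coordinate in
  -- `K` equal to that of `m`.
  let k : K := (h.equiv (φ m)).2
  let ι : F → E := fun z => h.equiv.symm (z, k)
  have hι : ContDiff ℝ ∞ ι := h.equiv.symm.contDiff.comp (contDiff_id.prodMk contDiff_const)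
  have hw : ∀ y ∈ φ.target, ψ (π (φ.symm y)) = (h.equiv y).1 := fun y hy => by
    have hy' : y ∈ (h.domChart.extend 𝓘(ℝ, E)).target := by simpa using hy
    simpa using h.writtenInCharts hy'
  have hψm : ψ (π m) = (h.equiv (φ m)).1 := by
    have := hw (φ m) (φ.map_source hφm)
    rwa [φ.left_inv hφm] at this
  have hιm : ι (ψ (π m)) = φ m := by
    simp only [ι, k, hψm, Prod.mk.eta, ContinuousLinearEquiv.symm_apply_apply]
  have hπs := h.mem_codChart_source
  have hmaps := h.mapsto_domChart_source_codChart_source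
  refine ⟨fun c => φ.symm (ι (ψ c)), ψ.source ∩ ψ ⁻¹' (ι ⁻¹' φ.target), ?_, ?_, ?_, ?_, ?_⟩
  · exact ψ.isOpen_inter_preimage (φ.open_target.preimage hι.continuous)
  · refine ⟨hπs, ?_⟩
    change ι (ψ (π m)) ∈ φ.target
    rw [hιm]; exact φ.map_source hφm
  · change φ.symm (ι (ψ (π m))) = m
    rw [hιm, φ.left_inv hφm]
  · rintro c ⟨hc, hc'⟩
    have h1 : ContMDiffAt 𝓘(ℝ, F) 𝓘(ℝ, F) ∞ ψ c :=
      contMDiffAt_of_mem_maximalAtlas h.codChart_mem_maximalAtlas hc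
    have h2 : ContMDiffAt 𝓘(ℝ, E) 𝓘(ℝ, E) ∞ φ.symm (ι (ψ c)) :=
      contMDiffAt_symm_of_mem_maximalAtlas h.domChart_mem_maximalAtlas hc'
    exact h2.comp c (hι.contMDiff.contMDiffAt.comp c h1)
  · rintro c ⟨hc, hc'⟩
    have h3 := hw _ hc'
    change ψ (π (φ.symm (ι (ψ c)))) = _ at h3
    refine ψ.injOn (hmaps (φ.map_target hc')) hc ?_
    rw [h3]
    simp [ι]

theorem tmap_section {π : M → C} (hπ : ContMDiff 𝓘(ℝ, E) 𝓘(ℝ, F) ∞ π) {σ : C → M} {U : Set C}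
    (hU : IsOpen U) (hσ : ∀ c ∈ U, ContMDiffAt 𝓘(ℝ, F) 𝓘(ℝ, E) ∞ σ c)
    (hπσ : ∀ c ∈ U, π (σ c) = c) {c : C} (hc : c ∈ U) (w : F) :
    tmap E F π (σ c) (tmap F E σ c w) = w := by
  have h := tmap_comp (hπ.mdifferentiableAt ne_zero_inf (x := σ c))
    ((hσ c hc).mdifferentiableAt ne_zero_inf)
  have h2 : tmap F F (π ∘ σ) c = tmap F F id c := tmap_congr (by
    filter_upwards [hU.mem_nhds hc] with x hx using hπσ x hx)
  rw [tmap_id, h] at h2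
  exact DFunLike.congr_fun h2 w

theorem tmap_surjective {π : M → C} (hπ : Manifold.IsSubmersion 𝓘(ℝ, E) 𝓘(ℝ, F) ∞ π) (m : M) :
    Function.Surjective (tmap E F π m) := by
  obtain ⟨σ, U, hU, hmU, hm, hσ, hπσ⟩ := exists_local_section hπ m
  intro w
  have := tmap_section hπ.contMDiff hU hσ hπσ hmU w
  rw [hm] at this
  exact ⟨_, this⟩

end Submersion

section MaximalCurve

variable {E : Type*} [NormedAddCommGroup E] [NormedSpace ℝ E]
  {M : Type*} [TopologicalSpace M] [ChartedSpace E M] [IsManifold 𝓘(ℝ, E) ∞ M]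
  {F : Type*} [NormedAddCommGroup F] [NormedSpace ℝ F]
  {C : Type*} [TopologicalSpace C] [ChartedSpace F C]

/-- The integral curves of `D` through `m` glue to a single curve defined on the union of their
intervals of definition, which thus runs through the whole class of `m`. -/
theorem exists_maximal_curve [T2Space M] {D : VField E M} (hD : D.Smooth) (m : M) :
    ∃ (Γ : ℝ → M) (s : Set ℝ), (∀ t ∈ s, MDifferentiableAt 𝓘(ℝ, ℝ) 𝓘(ℝ, E) Γ t) ∧
      ∀ m', OnCommonIntegralCurve D m m' ↔ ∃ t ∈ s, Γ t = m' := by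
  have := IsManifold.of_le (I := 𝓘(ℝ, E)) (M := M) (m := 1) (n := ∞) (by simp)
  -- `P t (γ, a, b)`: `γ` is an integral curve on `(a, b)` with `γ 0 = m`, and `t ∈ (a, b)`
  let P : ℝ → (ℝ → M) × ℝ × ℝ → Prop := fun t p =>
    IsMIntegralCurveOn p.1 D (Set.Ioo p.2.1 p.2.2) ∧ p.1 0 = m ∧
      0 ∈ Set.Ioo p.2.1 p.2.2 ∧ t ∈ Set.Ioo p.2.1 p.2.2
  have huniq : ∀ t p q, P t p → P t q → p.1 t = q.1 t := by
    rintro t ⟨γ, a, b⟩ ⟨γ', a', b'⟩ ⟨h1, h2, h3, h4⟩ ⟨h1', h2', h3', h4'⟩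
    refine isMIntegralCurveOn_Ioo_eqOn_of_contMDiff_boundaryless (t₀ := 0)
      (a := max a a') (b := min b b') ?_ (hD.of_le (m := 1) (by simp)) (h1.mono ?_) (h1'.mono ?_)
      (h2.trans h2'.symm) ?_
    · simp only [Set.mem_Ioo, max_lt_iff, lt_min_iff] at *; tauto
    · exact Set.Ioo_subset_Ioo (le_max_left _ _) (min_le_left _ _)
    · exact Set.Ioo_subset_Ioo (le_max_right _ _) (min_le_right _ _)
    · simp only [Set.mem_Ioo, max_lt_iff, lt_min_iff] at *; tauto
  classical
  let Γ : ℝ → M := fun t => if h : ∃ p, P t p then h.choose.1 t else m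
  have hΓ : ∀ t p, P t p → Γ t = p.1 t := by
    intro t p hp
    have h : ∃ p, P t p := ⟨p, hp⟩
    simp only [Γ, dif_pos h]
    exact huniq t _ _ h.choose_spec hp
  refine ⟨Γ, {t | ∃ p, P t p}, ?_, ?_⟩
  · rintro t ⟨p, hp⟩
    refine (hasMFDerivAt_of_curve isOpen_Ioo hp.1 hp.2.2.2).mdifferentiableAt.congr_of_eventuallyEq
      ?_
    filter_upwards [isOpen_Ioo.mem_nhds hp.2.2.2] with r hr
    exact hΓ r p ⟨hp.1, hp.2.1, hp.2.2.1, hr⟩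
  · intro m'
    constructor
    · rintro ⟨γ, s, hs, hs', hγ, t, ht, t', ht', rfl, rfl⟩
      -- an open interval around both times, slightly larger than the one they span, still lies
      -- in the domain of `γ`
      obtain ⟨ε, hε, hb⟩ := Metric.isOpen_iff.1 hs t ht
      obtain ⟨ε', hε', hb'⟩ := Metric.isOpen_iff.1 hs t' ht'
      set δ := min ε ε' / 2
      have hδ : 0 < δ := by positivity
      have hδ1 : δ < ε := (half_lt_self (lt_min hε hε')).trans_le (min_le_left _ _)
      have hδ2 : δ < ε' := (half_lt_self (lt_min hε hε')).trans_le (min_le_right _ _)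
      have hlo : min t t' - δ ∈ s := by
        rcases min_choice t t' with h | h <;> rw [h]
        · exact hb (by simp [abs_of_pos hδ, hδ1])
        · exact hb' (by simp [abs_of_pos hδ, hδ2])
      have hhi : max t t' + δ ∈ s := by
        rcases max_choice t t' with h | h <;> rw [h]
        · exact hb (by simp [abs_of_pos hδ, hδ1])
        · exact hb' (by simp [abs_of_pos hδ, hδ2])
      have hsub : Set.Ioo (min t t' - δ) (max t t' + δ) ⊆ s :=
        Set.Ioo_subset_Icc_self.trans (hs'.out hlo hhi)
      have hsh := (hγ.mono hsub).comp_add t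
      have hP : P (t' - t) (γ ∘ (· + t), min t t' - δ - t, max t t' + δ - t) := by
        refine ⟨hsh.mono ?_, by simp, ?_, ?_⟩
        · intro r hr
          simp only [Set.mem_Ioo, Set.mem_ofPred_eq] at *
          constructor <;> linarith
        · have := min_le_left t t'; have := le_max_left t t'
          constructor <;> dsimp only <;> linarith
        · have := min_le_right t t'; have := le_max_right t t'
          constructor <;> dsimp only <;> linarith
      refine ⟨t' - t, ⟨_, hP⟩, ?_⟩
      rw [hΓ _ _ hP]
      simp
    · rintro ⟨t, ⟨p, hp⟩, rfl⟩
      exact ⟨p.1, _, isOpen_Ioo, Set.ordConnected_Ioo, hp.1, 0, hp.2.2.1, t, hp.2.2.2, hp.2.1,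
        (hΓ t p hp).symm⟩

variable [FiniteDimensional ℝ E]

/-- `dπ(D) = 0`: along a local integral curve of `D`, `π` is constant. -/
theorem tmap_proj_field {D : VField E M} (hD : D.Smooth) {π : M → C}
    (hπ : IsQuotientBy (F := F) D π) (m : M) : tmap E F π m (D.val m) = 0 := by
  have := FiniteDimensional.complete ℝ E
  have := IsManifold.of_le (I := 𝓘(ℝ, E)) (M := M) (m := 1) (n := ∞) (by simp)
  obtain ⟨γ, hγ0, hγ⟩ := exists_isMIntegralCurveAt_of_contMDiffAt_boundaryless (t₀ := 0)
    ((hD.of_le (m := 1) (by simp)).contMDiffAt (x := m))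
  obtain ⟨ε, hε, hγ⟩ := isMIntegralCurveAt_iff'.1 hγ
  have h0 := Metric.mem_ball_self (x := (0 : ℝ)) hε
  have hd := hasMFDerivAt_of_curve Metric.isOpen_ball hγ h0
  have hconst : (π ∘ γ) =ᶠ[𝓝 0] fun _ => π m := by
    filter_upwards [Metric.isOpen_ball.mem_nhds h0] with t ht
    refine (hπ.fiber _ _).2 ⟨γ, _, Metric.isOpen_ball, ?_, hγ, t, ht, 0, h0, rfl, hγ0⟩
    rw [Real.ball_eq_Ioo]; exact Set.ordConnected_Ioo
  have h1 := tmap_comp (hπ.submersion.contMDiff.mdifferentiableAt ne_zero_inf (x := γ 0))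
    hd.mdifferentiableAt
  have h2 : tmap ℝ F (π ∘ γ) 0 = 0 := by
    rw [tmap_congr hconst]; exact mfderiv_const
  have h3 : tmap ℝ E γ 0 = (1 : ℝ →L[ℝ] ℝ).smulRight (D.val (γ 0)) := hd.mfderiv
  rw [h2, h3] at h1
  have h4 := DFunLike.congr_fun h1 1
  simp at h4
  rw [← hγ0]; exact h4.symm

end MaximalCurve

/-- A differentiable curve in a space of dimension at least two does not cover a non-empty open
set: its image is the image of a line, which has measure zero, under a differentiable map. -/
theorem finrank_le_one_of_curve_covers {K : Type*} [NormedAddCommGroup K] [NormedSpace ℝ K]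
    [FiniteDimensional ℝ K] {κ : ℝ → K} {s : Set ℝ} (hκ : ∀ t ∈ s, DifferentiableAt ℝ κ t)
    {U : Set K} (hU : IsOpen U) (hU' : U.Nonempty) (hcov : U ⊆ κ '' s) :
    Module.finrank ℝ K ≤ 1 := by
  by_contra! hdim
  have : Nontrivial K := Module.nontrivial_of_finrank_pos (R := ℝ) (by omega)
  obtain ⟨e, he⟩ := exists_ne (0 : K)
  obtain ⟨ℓ, hℓ⟩ := SeparatingDual.exists_eq_one (R := ℝ) he
  borelize K
  let μ : MeasureTheory.Measure K := MeasureTheory.Measure.addHaar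
  have hline : μ (Submodule.span ℝ {e} : Submodule ℝ K) = 0 := by
    refine MeasureTheory.Measure.addHaar_submodule μ _ fun htop => ?_
    have h1 := finrank_span_singleton (K := ℝ) he
    rw [htop, finrank_top] at h1
    omega
  let S : Set K := {x | ∃ t ∈ s, x = t • e}
  have hS : μ S = 0 := by
    refine MeasureTheory.measure_mono_null ?_ hline
    rintro _ ⟨t, -, rfl⟩
    exact Submodule.smul_mem _ _ (Submodule.mem_span_singleton_self e)
  have hdiff : DifferentiableOn ℝ (κ ∘ ℓ) S := by
    rintro _ ⟨t, ht, rfl⟩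
    refine DifferentiableAt.differentiableWithinAt (DifferentiableAt.comp _ ?_ ℓ.differentiableAt)
    simpa [hℓ] using hκ t ht
  have h0 := MeasureTheory.addHaar_image_eq_zero_of_differentiableOn_of_addHaar_eq_zero μ hdiff hS
  refine (hU.measure_pos μ hU').ne' (MeasureTheory.measure_mono_null ?_ h0)
  intro x hx
  obtain ⟨t, ht, rfl⟩ := hcov hx
  exact ⟨t • e, ⟨t, ht, rfl⟩, by simp [hℓ]⟩

section Fibers

variable {E : Type*} [NormedAddCommGroup E] [NormedSpace ℝ E] [FiniteDimensional ℝ E]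
  {M : Type*} [TopologicalSpace M] [ChartedSpace E M] [IsManifold 𝓘(ℝ, E) ∞ M] [T2Space M]
  {F : Type*} [NormedAddCommGroup F] [NormedSpace ℝ F] [FiniteDimensional ℝ F]
  {C : Type*} [TopologicalSpace C] [ChartedSpace F C]

/-- The fibers of the quotient map are at most one-dimensional, being covered by single integral
curves. -/
theorem finrank_le_of_quotient {D : VField E M} (hD : D.Smooth) {π : M → C}
    (hπ : IsQuotientBy (F := F) D π) (m : M) :
    Module.finrank ℝ E ≤ Module.finrank ℝ F + 1 := by
  obtain ⟨K, _, _, hK⟩ := hπ.submersion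
  have h := hK m
  set φ := h.domChart
  set ψ := h.codChart
  have hφm := h.mem_domChart_source
  have : FiniteDimensional ℝ (F × K) := h.equiv.toLinearEquiv.finiteDimensional
  have : FiniteDimensional ℝ K :=
    FiniteDimensional.of_surjective (LinearMap.snd ℝ F K) LinearMap.snd_surjective
  have hfr : Module.finrank ℝ E = Module.finrank ℝ F + Module.finrank ℝ K := by
    rw [h.equiv.toLinearEquiv.finrank_eq, Module.finrank_prod]
  rw [hfr]
  gcongr
  obtain ⟨Γ, s, hΓ, hcov⟩ := exists_maximal_curve hD m
  have hw : ∀ y ∈ φ.target, ψ (π (φ.symm y)) = (h.equiv y).1 := fun y hy => by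
    have hy' : y ∈ (h.domChart.extend 𝓘(ℝ, E)).target := by simpa using hy
    simpa using h.writtenInCharts hy'
  -- the slice through `m` along which `π` is constant; it is covered by the curve `Γ`
  let ι : K → E := fun k => h.equiv.symm ((h.equiv (φ m)).1, k)
  have hι : Continuous ι := h.equiv.symm.continuous.comp (by fun_prop)
  have hψm : ψ (π m) = (h.equiv (φ m)).1 := by
    have := hw (φ m) (φ.map_source hφm)
    rwa [φ.left_inv hφm] at this
  have hmaps := h.mapsto_domChart_source_codChart_source
  refine finrank_le_one_of_curve_covers (κ := fun t => (h.equiv (φ (Γ t))).2)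
    (s := {t ∈ s | Γ t ∈ φ.source}) ?_ (U := ι ⁻¹' φ.target) (φ.open_target.preimage hι) ?_ ?_
  · rintro t ⟨hts, htφ⟩
    have h1 : ContMDiffAt 𝓘(ℝ, E) 𝓘(ℝ, E) ∞ φ (Γ t) :=
      contMDiffAt_of_mem_maximalAtlas h.domChart_mem_maximalAtlas htφ
    have h2 := ((h1.mdifferentiableAt ne_zero_inf).comp t (hΓ t hts)).differentiableAt
    exact (ContinuousLinearMap.snd ℝ F K).differentiableAt.comp t
      (h.equiv.differentiableAt.comp t h2)
  · refine ⟨(h.equiv (φ m)).2, ?_⟩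
    simp only [Set.mem_preimage, ι, Prod.mk.eta, ContinuousLinearEquiv.symm_apply_apply]
    exact φ.map_source hφm
  · intro k hk
    have h1 : π m = π (φ.symm (ι k)) := by
      refine ψ.injOn (hmaps hφm) (hmaps (φ.map_target hk)) ?_
      rw [hψm, hw _ hk]
      simp [ι]
    obtain ⟨t, ht, hΓt⟩ := (hcov _).1 ((hπ.fiber _ _).1 h1)
    refine ⟨t, ⟨ht, ?_⟩, ?_⟩
    · rw [hΓt]; exact φ.map_target hk
    · simp only [hΓt]
      rw [φ.right_inv hk]
      simp [ι]

/-- Where `D` does not vanish, the vertical vectors are the multiples of `D`. -/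
theorem exists_smul_of_tmap_eq_zero {D : VField E M} (hD : D.Smooth) {π : M → C}
    (hπ : IsQuotientBy (F := F) D π) {m : M} (hDm : D.val m ≠ 0) {v : E}
    (hv : tmap E F π m v = 0) : ∃ a : ℝ, v = a • D.val m := by
  let T : E →ₗ[ℝ] F := (tmap E F π m).toLinearMap
  have h1 := T.finrank_range_add_finrank_ker
  rw [LinearMap.range_eq_top.2 (tmap_surjective hπ.submersion m), finrank_top] at h1
  have h2 := finrank_le_of_quotient hD hπ m
  have h3 : Module.finrank ℝ (LinearMap.ker T) ≤ 1 := by omega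
  let d : LinearMap.ker T := ⟨D.val m, tmap_proj_field hD hπ m⟩
  have hd : d ≠ 0 := fun h => hDm (congrArg Subtype.val h)
  have h4 : Module.finrank ℝ (LinearMap.ker T) = 1 :=
    le_antisymm h3 (Module.finrank_pos_iff_exists_ne_zero.2 ⟨d, hd⟩)
  obtain ⟨a, ha⟩ := (finrank_eq_one_iff_of_nonzero' d hd).1 h4 ⟨v, hv⟩
  exact ⟨a, (congrArg Subtype.val ha).symm⟩

end Fibers

/-! ### Projecting the Hamiltonian field -/

section ChartSmoothness

variable {E : Type*} [NormedAddCommGroup E] [NormedSpace ℝ E]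
  {M : Type*} [TopologicalSpace M] [ChartedSpace E M]
  {F : Type*} [NormedAddCommGroup F] [NormedSpace ℝ F]
  {C : Type*} [TopologicalSpace C] [ChartedSpace F C]
  {V : Type*} [NormedAddCommGroup V] [NormedSpace ℝ V]

theorem DForm.Smooth.contDiffAt_inChart {k : ℕ} {α : DForm E M k} (hα : α.Smooth) {x₀ : M} {y : E}
    (hy : y ∈ (extChartAt 𝓘(ℝ, E) x₀).target) : ContDiffAt ℝ ∞ (α.inChart x₀) y :=
  (hα x₀).contDiffAt (target_mem_nhds hy)

theorem inChart_two_apply (Ω : DForm E M 2) (x₀ : M) (y u v : E) :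
    Ω.inChart x₀ y ![u, v] = Ω.val ((extChartAt 𝓘(ℝ, E) x₀).symm y)
      ![tmap E E (extChartAt 𝓘(ℝ, E) x₀).symm y u, tmap E E (extChartAt 𝓘(ℝ, E) x₀).symm y v] := by
  rw [inChart_form_eq, ContinuousAlternatingMap.compContinuousLinearMap_apply]
  congr 1
  ext i; fin_cases i <;> rfl

theorem inChart_one_apply (β : DForm E M 1) (x₀ : M) (y v : E) :
    β.inChart x₀ y ![v] = β.val ((extChartAt 𝓘(ℝ, E) x₀).symm y)
      ![tmap E E (extChartAt 𝓘(ℝ, E) x₀).symm y v] := by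
  rw [inChart_form_eq, ContinuousAlternatingMap.compContinuousLinearMap_apply]
  congr 1
  ext i; fin_cases i; rfl

variable [IsManifold 𝓘(ℝ, E) ∞ M]

theorem contMDiffAt_iff_contDiffAt_symm {G : M → V} {x₀ x : M}
    (hx : x ∈ (extChartAt 𝓘(ℝ, E) x₀).source) :
    ContMDiffAt 𝓘(ℝ, E) 𝓘(ℝ, V) ∞ G x ↔
      ContDiffAt ℝ ∞ (G ∘ (extChartAt 𝓘(ℝ, E) x₀).symm) (extChartAt 𝓘(ℝ, E) x₀ x) := by
  rw [← contMDiffAt_iff_contDiffAt]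
  set φ := extChartAt 𝓘(ℝ, E) x₀
  constructor
  · intro h
    refine ContMDiffAt.comp (g := G) _ ?_ (contMDiffAt_symm (φ.map_source hx))
    rwa [φ.left_inv hx]
  · intro h
    refine (h.comp x (contMDiffAt_chart hx)).congr_of_eventuallyEq ?_
    filter_upwards [extChartAt_source_mem_nhds' (I := 𝓘(ℝ, E)) hx] with z hz
    exact (congrArg G (φ.left_inv hz)).symm

/-- Smoothness as a section of the tangent bundle is smoothness of the expression in a chart. -/
theorem contMDiffAt_vfield_iff {X : VField E M} {x₀ x : M}
    (hx : x ∈ (extChartAt 𝓘(ℝ, E) x₀).source) :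
    ContMDiffAt 𝓘(ℝ, E) (𝓘(ℝ, E).prod 𝓘(ℝ, E)) ∞
      (fun x => (⟨x, X x⟩ : TangentBundle 𝓘(ℝ, E) M)) x ↔
    ContDiffAt ℝ ∞ (X.inChart x₀) (extChartAt 𝓘(ℝ, E) x₀ x) := by
  have hsrc : (extChartAt 𝓘(ℝ, E) x₀).source = (chartAt E x₀).source := extChartAt_source _ _
  have h1 := (trivializationAt E (TangentSpace 𝓘(ℝ, E)) x₀).contMDiffAt_section_iff
    (IB := 𝓘(ℝ, E)) (n := ∞) (s := X) (x₀ := x)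
    (by rw [TangentBundle.trivializationAt_baseSet, ← hsrc]; exact hx)
  refine h1.trans ?_
  have h2 : (fun x => ((trivializationAt E (TangentSpace 𝓘(ℝ, E)) x₀) ⟨x, X x⟩).2) =ᶠ[𝓝 x]
      fun x => tmap E E (extChartAt 𝓘(ℝ, E) x₀) x (X.val x) := by
    filter_upwards [extChartAt_source_mem_nhds' (I := 𝓘(ℝ, E)) hx] with z hz
    rw [hsrc] at hz
    have h3 := TangentBundle.continuousLinearMapAt_trivializationAt (I := 𝓘(ℝ, E)) hz
    have h4 := DFunLike.congr_fun h3 (X z)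
    refine Eq.trans ?_ h4
    rw [Bundle.Trivialization.continuousLinearMapAt_apply,
      Bundle.Trivialization.linearMapAt_apply, if_pos]
    rw [TangentBundle.trivializationAt_baseSet]; exact hz
  rw [h2.contMDiffAt_iff, contMDiffAt_iff_contDiffAt_symm hx]
  rfl

theorem VField.Smooth.contDiffAt_inChart {X : VField E M} (hX : X.Smooth) {x₀ : M} {y : E}
    (hy : y ∈ (extChartAt 𝓘(ℝ, E) x₀).target) : ContDiffAt ℝ ∞ (X.inChart x₀) y := by
  have h := (contMDiffAt_vfield_iff ((extChartAt 𝓘(ℝ, E) x₀).map_target hy)).1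
    (hX.contMDiffAt)
  rwa [(extChartAt 𝓘(ℝ, E) x₀).right_inv hy] at h

theorem smooth_of_contDiffAt_inChart {X : VField E M}
    (h : ∀ x, ContDiffAt ℝ ∞ (X.inChart x) (extChartAt 𝓘(ℝ, E) x x)) : X.Smooth := fun x =>
  (contMDiffAt_vfield_iff (mem_extChartAt_source x)).2 (h x)

theorem contDiffAt_comp_symm {G : M → V} (hG : ContMDiff 𝓘(ℝ, E) 𝓘(ℝ, V) ∞ G) {x₀ : M} {y : E}
    (hy : y ∈ (extChartAt 𝓘(ℝ, E) x₀).target) :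
    ContDiffAt ℝ ∞ (G ∘ (extChartAt 𝓘(ℝ, E) x₀).symm) y := by
  rw [← contMDiffAt_iff_contDiffAt]
  exact hG.contMDiffAt.comp y (contMDiffAt_symm hy)

theorem fderiv_comp_symm {G : M → V} (hG : ContMDiff 𝓘(ℝ, E) 𝓘(ℝ, V) ∞ G) {x₀ : M} {y : E}
    (hy : y ∈ (extChartAt 𝓘(ℝ, E) x₀).target) (v : E) :
    fderiv ℝ (G ∘ (extChartAt 𝓘(ℝ, E) x₀).symm) y v =
      tmap E V G ((extChartAt 𝓘(ℝ, E) x₀).symm y) (tmap E E (extChartAt 𝓘(ℝ, E) x₀).symm y v) := by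
  rw [← tmap_eq_fderiv, tmap_comp (hG.mdifferentiableAt ne_zero_inf)
    ((contMDiffAt_symm hy).mdifferentiableAt ne_zero_inf)]
  rfl

theorem fderiv_comp_symm_self {G : M → V} (hG : ContMDiff 𝓘(ℝ, E) 𝓘(ℝ, V) ∞ G) (x : M) (v : E) :
    fderiv ℝ (G ∘ (extChartAt 𝓘(ℝ, E) x).symm) (extChartAt 𝓘(ℝ, E) x x) v = tmap E V G x v := by
  rw [fderiv_comp_symm hG (mem_extChartAt_target x), tmap_symm_self, extChartAt_to_inv]
  rfl

theorem fderiv_comp_symm_inChart {G : M → V} (hG : ContMDiff 𝓘(ℝ, E) 𝓘(ℝ, V) ∞ G)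
    (X : VField E M) {x₀ : M} {y : E}
    (hy : y ∈ (extChartAt 𝓘(ℝ, E) x₀).target) :
    fderiv ℝ (G ∘ (extChartAt 𝓘(ℝ, E) x₀).symm) y (X.inChart x₀ y) =
      tmap E V G ((extChartAt 𝓘(ℝ, E) x₀).symm y) (X.val ((extChartAt 𝓘(ℝ, E) x₀).symm y)) := by
  rw [fderiv_comp_symm hG hy, tmap_symm_inChart X hy]

/-- Near the centre of the chart around `x`, a map continuous at `x` takes values in the chart
around its value at `x`. -/
theorem eventually_mem_charts {g : M → C} {x : M} {c : C} (hg : ContinuousAt g x) (hx : g x = c) :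
    ∀ᶠ y in 𝓝 (extChartAt 𝓘(ℝ, E) x x), y ∈ (extChartAt 𝓘(ℝ, E) x).target ∧
      g ((extChartAt 𝓘(ℝ, E) x).symm y) ∈ (extChartAt 𝓘(ℝ, F) c).source := by
  have hxt := mem_extChartAt_target (I := 𝓘(ℝ, E)) x
  have h1 : ContinuousAt (g ∘ (extChartAt 𝓘(ℝ, E) x).symm) (extChartAt 𝓘(ℝ, E) x x) := by
    refine ContinuousAt.comp ?_ (contMDiffAt_symm hxt).continuousAt
    rwa [extChartAt_to_inv]
  refine Filter.Eventually.and (target_mem_nhds hxt) (h1.eventually_mem ?_)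
  subst hx
  rw [Function.comp_apply, extChartAt_to_inv]
  exact extChartAt_source_mem_nhds (g x)

end ChartSmoothness

section ScalingSymmetry

variable {E : Type*} [NormedAddCommGroup E] [NormedSpace ℝ E]
  {M : Type*} [TopologicalSpace M] [ChartedSpace E M] [IsManifold 𝓘(ℝ, E) ∞ M]

theorem nondegenerate_inChart {Ω : DForm E M 2} (hΩ : IsSymplectic Ω) {x₀ : M} {y : E}
    (hy : y ∈ (extChartAt 𝓘(ℝ, E) x₀).target) (u : E)
    (hu : ∀ v, Ω.inChart x₀ y ![u, v] = 0) : u = 0 := by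
  have h : tmap E E (extChartAt 𝓘(ℝ, E) x₀).symm y u = 0 := by
    refine hΩ.nondegenerate ((extChartAt 𝓘(ℝ, E) x₀).symm y) _ fun (v : E) => ?_
    have h1 := hu (tmap E E (extChartAt 𝓘(ℝ, E) x₀) ((extChartAt 𝓘(ℝ, E) x₀).symm y) v)
    rw [inChart_two_apply, tmap_symm_chart_apply hy] at h1
    exact h1
  rw [← tmap_chart_symm_apply hy u, h, map_zero]

theorem IsSymplectic.extDeriv_inChart {Ω : DForm E M 2} (hΩ : IsSymplectic Ω) (x : M) :
    extDeriv (Ω.inChart x) (extChartAt 𝓘(ℝ, E) x x) = 0 := by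
  have h : (extDeriv (Ω.inChart x) (extChartAt 𝓘(ℝ, E) x x)).compContinuousLinearMap
      (tmap E E (extChartAt 𝓘(ℝ, E) x) x) = 0 := congrFun hΩ.closed x
  rw [tmap_chart_self] at h
  exact h

/-- The invariance `L_D Ω = Ω` in the chart around `x`, at the centre of the chart. -/
theorem IsScalingSymmetry.lieDeriv_inChart {Ω : DForm E M 2} {H : M → ℝ} {D : VField E M} {Λ : ℝ}
    (hD : IsScalingSymmetry Ω H D Λ) (x : M) (u v : E) :
    fderiv ℝ (Ω.inChart x) (extChartAt 𝓘(ℝ, E) x x) (D.inChart x (extChartAt 𝓘(ℝ, E) x x))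
        ![u, v] +
      Ω.inChart x (extChartAt 𝓘(ℝ, E) x x)
        ![fderiv ℝ (D.inChart x) (extChartAt 𝓘(ℝ, E) x x) u, v] +
      Ω.inChart x (extChartAt 𝓘(ℝ, E) x x)
        ![u, fderiv ℝ (D.inChart x) (extChartAt 𝓘(ℝ, E) x x) v] =
      Ω.inChart x (extChartAt 𝓘(ℝ, E) x x) ![u, v] := by
  set y := extChartAt 𝓘(ℝ, E) x x
  have h := hD.form x ![u, v]
  have hw : ∀ i, (tmap E E (extChartAt 𝓘(ℝ, E) x) x) ((![u, v] : Fin 2 → E) i) =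
      (![u, v] : Fin 2 → E) i := fun i => by
    rw [tmap_chart_self]; rfl
  have h1 : fderiv ℝ (Ω.inChart x) y (D.inChart x y)
        (fun i => tmap E E (extChartAt 𝓘(ℝ, E) x) x ((![u, v] : Fin 2 → E) i)) +
      ∑ i, Ω.inChart x y (Function.update
        (fun i => tmap E E (extChartAt 𝓘(ℝ, E) x) x ((![u, v] : Fin 2 → E) i)) i
        (fderiv ℝ (D.inChart x) y
          (tmap E E (extChartAt 𝓘(ℝ, E) x) x ((![u, v] : Fin 2 → E) i)))) =
      Ω.val x ![u, v] := h
  simp only [hw] at h1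
  rw [← inChart_form_self, Fin.sum_univ_two, ← add_assoc] at h1
  convert h1 using 4 <;> · ext i; fin_cases i <;> rfl

theorem IsScalingSymmetry.tmap_apply {Ω : DForm E M 2} {H : M → ℝ} {D : VField E M}
    (hD : IsScalingSymmetry Ω H D 1) (m : M) : tmap E ℝ H m (D.val m) = H m :=
  (hD.hamiltonian m).trans (one_mul _)

end ScalingSymmetry

section HamiltonianField

variable {E : Type*} [NormedAddCommGroup E] [NormedSpace ℝ E] [FiniteDimensional ℝ E]
  {M : Type*} [TopologicalSpace M] [ChartedSpace E M]

theorem hamiltonianVF_apply {Ω : DForm E M 2} (hΩ : IsSymplectic Ω) (H : M → ℝ) (m : M) (v : E) :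
    Ω.val m ![(hamiltonianVF Ω H).val m, v] = -tmap E ℝ H m v :=
  (hamiltonianVF_spec hΩ H m _).2 rfl v

variable [IsManifold 𝓘(ℝ, E) ∞ M]

theorem hamiltonianVF_inChart {Ω : DForm E M 2} (hΩ : IsSymplectic Ω) {H : M → ℝ}
    (hH : ContMDiff 𝓘(ℝ, E) 𝓘(ℝ, ℝ) ∞ H) {x₀ : M} {y : E}
    (hy : y ∈ (extChartAt 𝓘(ℝ, E) x₀).target) (v : E) :
    Ω.inChart x₀ y ![(hamiltonianVF Ω H).inChart x₀ y, v] =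
      -fderiv ℝ (H ∘ (extChartAt 𝓘(ℝ, E) x₀).symm) y v := by
  rw [inChart_two_apply, tmap_symm_inChart _ hy, hamiltonianVF_apply hΩ, fderiv_comp_symm hH hy]

theorem contDiffAt_hamiltonianVF_inChart {Ω : DForm E M 2} (hΩ : IsSymplectic Ω) {H : M → ℝ}
    (hH : ContMDiff 𝓘(ℝ, E) 𝓘(ℝ, ℝ) ∞ H) {x₀ : M} {y : E}
    (hy : y ∈ (extChartAt 𝓘(ℝ, E) x₀).target) :
    ContDiffAt ℝ ∞ ((hamiltonianVF Ω H).inChart x₀) y := by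
  refine contDiffAt_of_hamiltonian (hΩ.smooth.contDiffAt_inChart hy) (contDiffAt_comp_symm hH hy)
    (nondegenerate_inChart hΩ hy) ?_
  filter_upwards [target_mem_nhds hy] with z hz
  exact hamiltonianVF_inChart hΩ hH hz

theorem hamiltonianVF_smooth {Ω : DForm E M 2} (hΩ : IsSymplectic Ω) {H : M → ℝ}
    (hH : ContMDiff 𝓘(ℝ, E) 𝓘(ℝ, ℝ) ∞ H) : (hamiltonianVF Ω H).Smooth :=
  smooth_of_contDiffAt_inChart fun x =>
    contDiffAt_hamiltonianVF_inChart hΩ hH (mem_extChartAt_target x)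

/-- `[D, X_H] = 0`, in the chart around `x`, at the centre of the chart. -/
theorem IsScalingSymmetry.comm_hamiltonianVF {Ω : DForm E M 2} (hΩ : IsSymplectic Ω) {H : M → ℝ}
    (hH : ContMDiff 𝓘(ℝ, E) 𝓘(ℝ, ℝ) ∞ H) {D : VField E M}
    (hD : IsScalingSymmetry Ω H D 1) (x : M) :
    fderiv ℝ ((hamiltonianVF Ω H).inChart x) (extChartAt 𝓘(ℝ, E) x x)
      (D.inChart x (extChartAt 𝓘(ℝ, E) x x)) =
    fderiv ℝ (D.inChart x) (extChartAt 𝓘(ℝ, E) x x)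
      ((hamiltonianVF Ω H).inChart x (extChartAt 𝓘(ℝ, E) x x)) := by
  have hx := mem_extChartAt_target (I := 𝓘(ℝ, E)) x
  refine fderiv_comm_of_scaling (W := Ω.inChart x) (H := H ∘ (extChartAt 𝓘(ℝ, E) x).symm)
    ((hΩ.smooth.contDiffAt_inChart hx).differentiableAt ne_zero_inf)
    ((hD.smooth.contDiffAt_inChart hx).differentiableAt ne_zero_inf)
    ((contDiffAt_hamiltonianVF_inChart hΩ hH hx).differentiableAt ne_zero_inf)
    (contDiffAt_comp_symm hH hx) (nondegenerate_inChart hΩ hx) ?_ ?_ (hD.lieDeriv_inChart x)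
  · filter_upwards [target_mem_nhds hx] with z hz
    exact hamiltonianVF_inChart hΩ hH hz
  · filter_upwards [target_mem_nhds hx] with z hz
    rw [fderiv_comp_symm_inChart hH D hz, hD.tmap_apply]
    rfl

end HamiltonianField

section Related

variable {E : Type*} [NormedAddCommGroup E] [NormedSpace ℝ E]
  {M : Type*} [TopologicalSpace M] [ChartedSpace E M] [IsManifold 𝓘(ℝ, E) ∞ M]
  {F : Type*} [NormedAddCommGroup F] [NormedSpace ℝ F]
  {C : Type*} [TopologicalSpace C] [ChartedSpace F C] [IsManifold 𝓘(ℝ, F) ∞ C]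

/-- A field to which a smooth field projects is smooth: over the domain of a local section `σ` it is
`dπ(Y ∘ σ)`. -/
theorem smooth_of_related {π : M → C} (hπ : Manifold.IsSubmersion 𝓘(ℝ, E) 𝓘(ℝ, F) ∞ π)
    (hsurj : Function.Surjective π) {Y : VField E M} (hY : Y.Smooth) {X : VField F C}
    (hX : ∀ m, tmap E F π m (Y.val m) = X.val (π m)) : X.Smooth := by
  refine smooth_of_contDiffAt_inChart fun c => ?_
  obtain ⟨m, rfl⟩ := hsurj c
  obtain ⟨σ, U, hU, hmU, hm, hσ, hπσ⟩ := exists_local_section hπ m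
  have hπs := hπ.contMDiff
  have hct := mem_extChartAt_target (I := 𝓘(ℝ, F)) (π m)
  have hmt := mem_extChartAt_target (I := 𝓘(ℝ, E)) m
  set z₀ := extChartAt 𝓘(ℝ, F) (π m) (π m) with hz₀
  have hz₀' : (extChartAt 𝓘(ℝ, F) (π m)).symm z₀ = π m := extChartAt_to_inv _
  have hs : ContDiffAt ℝ ∞ (rep F E σ (π m) m) z₀ := by
    refine contDiffAt_rep hct ?_ ?_
    · rw [hz₀']; exact hσ _ hmU
    · rw [hz₀', hm]; exact mem_extChartAt_source m
  have hs0 : rep F E σ (π m) m z₀ = extChartAt 𝓘(ℝ, E) m m := by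
    simp only [rep, Function.comp_apply, hz₀', hm]
  have hrep : ContDiffAt ℝ ∞ (rep E F π m (π m)) (rep F E σ (π m) m z₀) := by
    rw [hs0]
    refine contDiffAt_rep hmt hπs.contMDiffAt ?_
    rw [extChartAt_to_inv]; exact mem_extChartAt_source _
  have hYc : ContDiffAt ℝ ∞ (Y.inChart m) (rep F E σ (π m) m z₀) := by
    rw [hs0]; exact hY.contDiffAt_inChart hmt
  refine ContDiffAt.congr_of_eventuallyEq
    (((hrep.fderiv_right (m := ∞) (by norm_cast)).comp z₀ hs).clm_apply (hYc.comp z₀ hs)) ?_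
  have hev1 : ∀ᶠ z in 𝓝 z₀, (extChartAt 𝓘(ℝ, F) (π m)).symm z ∈ U :=
    (contMDiffAt_symm hct).continuousAt.eventually_mem (by rw [hz₀']; exact hU.mem_nhds hmU)
  filter_upwards [hev1, eventually_mem_charts (E := F) (F := E) (hσ _ hmU).continuousAt hm]
    with z hzU hz
  obtain ⟨hz, hzm⟩ := hz
  have h1 : (extChartAt 𝓘(ℝ, E) m).symm (rep F E σ (π m) m z) =
      σ ((extChartAt 𝓘(ℝ, F) (π m)).symm z) := (extChartAt 𝓘(ℝ, E) m).left_inv hzm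
  have hzt : rep F E σ (π m) m z ∈ (extChartAt 𝓘(ℝ, E) m).target :=
    (extChartAt 𝓘(ℝ, E) m).map_source hzm
  have hc : π ((extChartAt 𝓘(ℝ, E) m).symm (rep F E σ (π m) m z)) ∈
      (extChartAt 𝓘(ℝ, F) (π m)).source := by
    rw [h1, hπσ _ hzU]; exact (extChartAt 𝓘(ℝ, F) (π m)).map_target hz
  have h2 := fderiv_rep_inChart Y hzt (hπs.mdifferentiableAt ne_zero_inf) hc
  rw [hX, h1, hπσ _ hzU] at h2
  exact h2.symm

end Related

section Descent

variable {E : Type*} [NormedAddCommGroup E] [NormedSpace ℝ E]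
  {M : Type*} [TopologicalSpace M] [ChartedSpace E M] [IsManifold 𝓘(ℝ, E) ∞ M]
  {F : Type*} [NormedAddCommGroup F] [NormedSpace ℝ F]
  {C : Type*} [TopologicalSpace C] [ChartedSpace F C]
  {V : Type*} [NormedAddCommGroup V] [NormedSpace ℝ V]

/-- If the derivative along `D` of `G`, computed in charts, vanishes on the fiber over `c`, then
`G` is constant on this fiber. -/
theorem eq_on_fiber {D : VField E M} {π : M → C}
    (hπ : IsQuotientBy (F := F) D π) {c : C} {G : M → V}
    (hG : ∀ x, π x = c → DifferentiableAt ℝ (G ∘ (extChartAt 𝓘(ℝ, E) x).symm)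
        (extChartAt 𝓘(ℝ, E) x x) ∧
      fderiv ℝ (G ∘ (extChartAt 𝓘(ℝ, E) x).symm) (extChartAt 𝓘(ℝ, E) x x)
        (D.inChart x (extChartAt 𝓘(ℝ, E) x x)) = 0)
    {m m' : M} (hm : π m = c) (hm' : π m' = c) : G m = G m' := by
  obtain ⟨γ, s, hs, hs', hγ, t, ht, t', ht', rfl, rfl⟩ := (hπ.fiber m m').1 (hm.trans hm'.symm)
  refine eq_on_curve hs hs' hγ (fun r hr => ?_) ht ht'
  have hr : π (γ r) = c := by
    rw [← hm]
    exact (hπ.fiber _ _).2 ⟨γ, s, hs, hs', hγ, r, hr, t, ht, rfl, rfl⟩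
  rw [← inChart_vfield_self]
  exact hG _ hr

variable [FiniteDimensional ℝ E] [IsManifold 𝓘(ℝ, F) ∞ C]

theorem eventually_fderiv_rep_field {D : VField E M} (hD : D.Smooth) {π : M → C}
    (hπ : IsQuotientBy (F := F) D π) {x : M} {c : C} (hx : π x = c) :
    ∀ᶠ y in 𝓝 (extChartAt 𝓘(ℝ, E) x x), fderiv ℝ (rep E F π x c) y (D.inChart x y) = 0 := by
  have hπs := hπ.submersion.contMDiff
  filter_upwards [eventually_mem_charts (E := E) (F := F) hπs.continuous.continuousAt hx] with z hz
  rw [fderiv_rep_inChart D hz.1 (hπs.mdifferentiableAt ne_zero_inf) hz.2, tmap_proj_field hD hπ,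
    map_zero]

/-- `dπ(X_H)` is constant along the fibers. -/
theorem tmap_hamiltonianVF_eq {Ω : DForm E M 2} (hΩ : IsSymplectic Ω) {H : M → ℝ}
    (hH : ContMDiff 𝓘(ℝ, E) 𝓘(ℝ, ℝ) ∞ H) {D : VField E M}
    (hD : IsScalingSymmetry Ω H D 1) {π : M → C} (hπ : IsQuotientBy (F := F) D π)
    {m m' : M} (hm : π m = π m') :
    tmap E F π m ((hamiltonianVF Ω H).val m) = tmap E F π m' ((hamiltonianVF Ω H).val m') := by
  have hπs := hπ.submersion.contMDiff
  let G : M → F := fun x => tmap F F (extChartAt 𝓘(ℝ, F) (π m)) (π x)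
    (tmap E F π x ((hamiltonianVF Ω H).val x))
  have h : G m = G m' := by
    refine eq_on_fiber hπ (c := π m) (fun x hx => ?_) rfl hm.symm
    have hxt := mem_extChartAt_target (I := 𝓘(ℝ, E)) x
    have hev := eventually_mem_charts (E := E) (F := F) hπs.continuous.continuousAt hx
    have h1 : G ∘ (extChartAt 𝓘(ℝ, E) x).symm =ᶠ[𝓝 (extChartAt 𝓘(ℝ, E) x x)]
        fun y => fderiv ℝ (rep E F π x (π m)) y ((hamiltonianVF Ω H).inChart x y) := by
      filter_upwards [hev] with y hy
      exact (fderiv_rep_inChart _ hy.1 (hπs.mdifferentiableAt ne_zero_inf) hy.2).symm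
    have hrep : ContDiffAt ℝ ∞ (rep E F π x (π m)) (extChartAt 𝓘(ℝ, E) x x) :=
      contDiffAt_rep hxt hπs.contMDiffAt hev.self_of_nhds.2
    have hX := (contDiffAt_hamiltonianVF_inChart hΩ hH hxt).differentiableAt ne_zero_inf
    refine ⟨DifferentiableAt.congr_of_eventuallyEq ?_ h1, ?_⟩
    · exact ((hrep.fderiv_right (m := 1) (by norm_cast)).differentiableAt (by simp)).clm_apply hX
    · rw [h1.fderiv_eq]
      exact fderiv_proj_eq_zero hrep
        ((hD.smooth.contDiffAt_inChart hxt).differentiableAt ne_zero_inf) hX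
        (eventually_fderiv_rep_field hD.smooth hπ hx) (hD.comm_hamiltonianVF hΩ hH x)
  simp only [G] at h
  rw [← hm, tmap_chart_self] at h
  exact h

theorem existsUnique_pushforward {Ω : DForm E M 2} (hΩ : IsSymplectic Ω) {H : M → ℝ}
    (hH : ContMDiff 𝓘(ℝ, E) 𝓘(ℝ, ℝ) ∞ H) {D : VField E M}
    (hD : IsScalingSymmetry Ω H D 1) {π : M → C} (hπ : IsQuotientBy (F := F) D π) :
    ∃! X : VField F C, IsPushforward π (hamiltonianVF Ω H) X := by
  let s := Function.surjInv hπ.surjective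
  have hs : ∀ c, π (s c) = c := Function.surjInv_eq hπ.surjective
  let X : VField F C := fun c => tmap E F π (s c) ((hamiltonianVF Ω H).val (s c))
  have hX : ∀ m, tmap E F π m ((hamiltonianVF Ω H).val m) = X.val (π m) := fun m =>
    tmap_hamiltonianVF_eq hΩ hH hD hπ (hs (π m)).symm
  refine ⟨X, ⟨smooth_of_related hπ.submersion hπ.surjective (hamiltonianVF_smooth hΩ hH) hX, hX⟩,
    fun X' hX' => funext fun c => ?_⟩
  obtain ⟨m, rfl⟩ := hπ.surjective c
  exact (hX'.related m).symm.trans (hX m)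

end Descent

/-! ### The contact form -/

section OneForms

variable {E : Type*} [NormedAddCommGroup E] [NormedSpace ℝ E]
  {M : Type*} [TopologicalSpace M] [ChartedSpace E M]
  {F : Type*} [NormedAddCommGroup F] [NormedSpace ℝ F]
  {C : Type*} [TopologicalSpace C] [ChartedSpace F C]

theorem one_form_ext {a b : E [⋀^Fin 1]→L[ℝ] ℝ} (h : ∀ v, a ![v] = b ![v]) : a = b := by
  refine oneFormEquiv.injective (ContinuousLinearMap.ext fun v => ?_)
  rw [oneFormEquiv_apply, oneFormEquiv_apply, h]

theorem contDiffAt_compContinuousLinearMap {α : F → E [⋀^Fin 1]→L[ℝ] ℝ} {T : F → F →L[ℝ] E}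
    {z : F} (hα : ContDiffAt ℝ ∞ α z) (hT : ContDiffAt ℝ ∞ T z) :
    ContDiffAt ℝ ∞ (fun z => (α z).compContinuousLinearMap (T z)) z := by
  have h : ContDiffAt ℝ ∞ (fun z => oneFormEquiv.symm ((oneFormEquiv (α z)).comp (T z))) z := by
    refine (oneFormEquiv (E := F)).symm.contDiff.contDiffAt.comp z ?_
    exact ((oneFormEquiv (E := E)).contDiff.contDiffAt.comp z hα).clm_comp hT
  refine h.congr_of_eventuallyEq (Filter.Eventually.of_forall fun z => ?_)
  refine oneFormEquiv.injective (ContinuousLinearMap.ext fun v => ?_)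
  rw [LinearIsometryEquiv.apply_symm_apply, ContinuousLinearMap.comp_apply, oneFormEquiv_apply,
    oneFormEquiv_apply, ContinuousAlternatingMap.compContinuousLinearMap_apply]
  congr 1
  ext i; fin_cases i; rfl

theorem pullback_one_apply (η : DForm F C 1) (π : M → C) (m : M) (v : E) :
    (η.pullback (E := E) π).val m ![v] = η.val (π m) ![tmap E F π m v] := by
  change η.val (π m) (fun i => tmap E F π m ((![v] : Fin 1 → E) i)) = _
  congr 1
  ext i; fin_cases i; rfl

variable [IsManifold 𝓘(ℝ, E) ∞ M] [IsManifold 𝓘(ℝ, F) ∞ C]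

/-- A form on the base of a submersion is smooth if its pull-back is: it is recovered from the
pull-back by means of local sections. -/
theorem smooth_of_pullback {π : M → C} (hπ : Manifold.IsSubmersion 𝓘(ℝ, E) 𝓘(ℝ, F) ∞ π)
    (hsurj : Function.Surjective π) {η : DForm F C 1} (hη : (η.pullback (E := E) π).Smooth) :
    η.Smooth := by
  intro c₀ z₀ hz₀
  refine ContDiffAt.contDiffWithinAt ?_
  set c := (extChartAt 𝓘(ℝ, F) c₀).symm z₀ with hc
  obtain ⟨m, hm⟩ := hsurj c
  obtain ⟨σ, U, hU, hmU, hσm, hσ, hπσ⟩ := exists_local_section hπ m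
  rw [hm] at hmU hσm
  have hπs := hπ.contMDiff
  have hmt := mem_extChartAt_target (I := 𝓘(ℝ, E)) m
  have hs : ContDiffAt ℝ ∞ (rep F E σ c₀ m) z₀ := by
    refine contDiffAt_rep hz₀ (hσ _ hmU) ?_
    rw [← hc, hσm]; exact mem_extChartAt_source m
  have hs0 : rep F E σ c₀ m z₀ = extChartAt 𝓘(ℝ, E) m m := by
    simp only [rep, Function.comp_apply, ← hc, hσm]
  have hβ : ContDiffAt ℝ ∞ ((η.pullback (E := E) π).inChart m) (rep F E σ c₀ m z₀) := by
    rw [hs0]; exact hη.contDiffAt_inChart hmt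
  refine ContDiffAt.congr_of_eventuallyEq (contDiffAt_compContinuousLinearMap (hβ.comp z₀ hs)
    (hs.fderiv_right (m := ∞) (by norm_cast))) ?_
  have hcont := (contMDiffAt_symm hz₀).continuousAt
  have hev1 : ∀ᶠ z in 𝓝 z₀, (extChartAt 𝓘(ℝ, F) c₀).symm z ∈ U :=
    hcont.eventually_mem (hU.mem_nhds hmU)
  have hev2 : ∀ᶠ z in 𝓝 z₀, σ ((extChartAt 𝓘(ℝ, F) c₀).symm z) ∈
      (extChartAt 𝓘(ℝ, E) m).source := by
    refine (ContinuousAt.comp (g := σ) (hσ _ hmU).continuousAt hcont).eventually_mem ?_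
    change _ ∈ 𝓝 (σ c)
    rw [hσm]; exact extChartAt_source_mem_nhds m
  filter_upwards [target_mem_nhds hz₀, hev1, hev2] with z hz hzU hzm
  have h1 := inChart_pullback (c₀ := m) (η.pullback (E := E) π) (g := σ) hz
    ((hσ _ hzU).mdifferentiableAt ne_zero_inf) hzm
  refine Eq.trans (one_form_ext fun w => ?_) h1
  rw [inChart_one_apply, inChart_one_apply, pullback_one_apply, pullback_one_apply,
    tmap_section hπs hU hσ hπσ hzU, hπσ _ hzU]

/-- The exterior derivative commutes with pull-back. -/
theorem d_pullback_apply {π : M → C} (hπ : ContMDiff 𝓘(ℝ, E) 𝓘(ℝ, F) ∞ π)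
    {η : DForm F C 1} (hη : η.Smooth) (m : M) (u v : E) :
    η.d.val (π m) ![tmap E F π m u, tmap E F π m v] =
      extDeriv ((η.pullback (E := E) π).inChart m) (extChartAt 𝓘(ℝ, E) m m) ![u, v] := by
  have hmt := mem_extChartAt_target (I := 𝓘(ℝ, E)) m
  have hev := eventually_mem_charts (E := E) (F := F) hπ.continuous.continuousAt
    (rfl : π m = π m)
  set y₀ := extChartAt 𝓘(ℝ, E) m m with hy₀
  have hrep0 : rep E F π m (π m) y₀ = extChartAt 𝓘(ℝ, F) (π m) (π m) := by
    simp only [rep, Function.comp_apply, hy₀, extChartAt_to_inv]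
  have h1 : (η.pullback (E := E) π).inChart m =ᶠ[𝓝 y₀] fun y =>
      (η.inChart (π m) (rep E F π m (π m) y)).compContinuousLinearMap
        (fderiv ℝ (rep E F π m (π m)) y) := by
    filter_upwards [hev] with y hy
    exact inChart_pullback η hy.1 (hπ.mdifferentiableAt ne_zero_inf) hy.2
  have hd : DifferentiableAt ℝ (η.inChart (π m)) (rep E F π m (π m) y₀) := by
    rw [hrep0]
    exact (hη.contDiffAt_inChart (mem_extChartAt_target _)).differentiableAt ne_zero_inf
  have hr : ContDiffAt ℝ ∞ (rep E F π m (π m)) y₀ :=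
    contDiffAt_rep hmt hπ.contMDiffAt hev.self_of_nhds.2
  have hfd : fderiv ℝ (rep E F π m (π m)) y₀ = tmap E F π m := by
    rw [fderiv_rep hmt (hπ.mdifferentiableAt ne_zero_inf) hev.self_of_nhds.2]
    simp only [hy₀, extChartAt_to_inv, tmap_symm_self, tmap_chart_self]
    rfl
  rw [h1.extDeriv_eq, extDeriv_pullback hd hr (by simp; norm_cast), hfd, hrep0]
  change extDeriv (η.inChart (π m)) (extChartAt 𝓘(ℝ, F) (π m) (π m))
    (fun i => tmap F F (extChartAt 𝓘(ℝ, F) (π m)) (π m)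
      ((![tmap E F π m u, tmap E F π m v] : Fin 2 → F) i)) = _
  rw [tmap_chart_self, ContinuousAlternatingMap.compContinuousLinearMap_apply]
  congr 1
  ext i; fin_cases i <;> rfl

end OneForms

section ScaledForm

variable {E : Type*} [NormedAddCommGroup E] [NormedSpace ℝ E]
  {M : Type*} [TopologicalSpace M] [ChartedSpace E M]

/-- The one-form `λ / ρ`, where `λ = i_D Ω`. -/
def scaledForm (Ω : DForm E M 2) (D : VField E M) (ρ : M → ℝ) : DForm E M 1 :=
  fun m => (ρ m)⁻¹ • Ω.interior D m

theorem scaledForm_apply (Ω : DForm E M 2) (D : VField E M) (ρ : M → ℝ) (m : M) (v : E) :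
    (scaledForm Ω D ρ).val m ![v] = (ρ m)⁻¹ * Ω.val m ![D.val m, v] := rfl

/-- At a zero of `D`, the equation `dρ(D) = ρ` would force `ρ = 0`. -/
theorem field_ne_zero {D : VField E M} {ρ : M → ℝ} (hρ : IsScalingFunction D ρ) (m : M) :
    D.val m ≠ 0 := fun h => by
  have h1 : tmap E ℝ ρ m (D.val m) = ρ m := hρ.scaling m
  rw [h, map_zero] at h1
  exact hρ.ne_zero m h1.symm

variable [IsManifold 𝓘(ℝ, E) ∞ M]

theorem scaledForm_inChart (Ω : DForm E M 2) (D : VField E M) (ρ : M → ℝ) {x₀ : M} {y : E}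
    (hy : y ∈ (extChartAt 𝓘(ℝ, E) x₀).target) :
    (scaledForm Ω D ρ).inChart x₀ y = ((ρ ∘ (extChartAt 𝓘(ℝ, E) x₀).symm) y)⁻¹ •
      (Ω.inChart x₀ y).curryLeft (D.inChart x₀ y) := by
  rw [← inChart_interior D Ω hy]
  rfl

variable {Ω : DForm E M 2} {D : VField E M} {ρ : M → ℝ}

theorem contDiffAt_scaledForm (hΩ : Ω.Smooth) (hD : D.Smooth) (hρ : IsScalingFunction D ρ)
    {x₀ : M} {y : E} (hy : y ∈ (extChartAt 𝓘(ℝ, E) x₀).target) :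
    ContDiffAt ℝ ∞ ((scaledForm Ω D ρ).inChart x₀) y := by
  have h1 : ContDiffAt ℝ ∞ (fun y => ((ρ ∘ (extChartAt 𝓘(ℝ, E) x₀).symm) y)⁻¹) y :=
    (contDiffAt_comp_symm hρ.smooth hy).inv (hρ.ne_zero _)
  have h2 : ContDiffAt ℝ ∞ (fun y => (Ω.inChart x₀ y).curryLeft (D.inChart x₀ y)) y :=
    ((contDiff_curryLeft (E := E) 1).contDiffAt.comp y (hΩ.contDiffAt_inChart hy)).clm_apply
      (hD.contDiffAt_inChart hy)
  refine (h1.smul h2).congr_of_eventuallyEq ?_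
  filter_upwards [target_mem_nhds hy] with z hz
  exact scaledForm_inChart Ω D ρ hz

theorem scaledForm_smooth (hΩ : Ω.Smooth) (hD : D.Smooth) (hρ : IsScalingFunction D ρ) :
    (scaledForm Ω D ρ).Smooth := fun _ _ hy =>
  (contDiffAt_scaledForm hΩ hD hρ hy).contDiffWithinAt

theorem mul_scaledForm_inChart (hρ : IsScalingFunction D ρ) {x₀ : M} {y : E}
    (hy : y ∈ (extChartAt 𝓘(ℝ, E) x₀).target) (v : E) :
    (ρ ∘ (extChartAt 𝓘(ℝ, E) x₀).symm) y * (scaledForm Ω D ρ).inChart x₀ y ![v] =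
      Ω.inChart x₀ y ![D.inChart x₀ y, v] := by
  rw [scaledForm_inChart Ω D ρ hy]
  change _ * (_⁻¹ * Ω.inChart x₀ y ![D.inChart x₀ y, v]) = _
  exact mul_inv_cancel_left₀ (hρ.ne_zero _) _

/-- `ρ dβ = Ω - dρ ∧ β` for `β = λ / ρ`. -/
theorem extDeriv_scaledForm (hΩ : IsSymplectic Ω) {H : M → ℝ} (hD : IsScalingSymmetry Ω H D 1)
    (hρ : IsScalingFunction D ρ) (m : M) (u v : E) :
    ρ m * extDeriv ((scaledForm Ω D ρ).inChart m) (extChartAt 𝓘(ℝ, E) m m) ![u, v] =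
      Ω.val m ![u, v] - (tmap E ℝ ρ m u * (scaledForm Ω D ρ).val m ![v] -
        tmap E ℝ ρ m v * (scaledForm Ω D ρ).val m ![u]) := by
  have hmt := mem_extChartAt_target (I := 𝓘(ℝ, E)) m
  have h := extDeriv_scaled_interior (W := Ω.inChart m) (d := D.inChart m)
    (β := (scaledForm Ω D ρ).inChart m) (r := ρ ∘ (extChartAt 𝓘(ℝ, E) m).symm)
    ((hΩ.smooth.contDiffAt_inChart hmt).differentiableAt ne_zero_inf)
    ((hD.smooth.contDiffAt_inChart hmt).differentiableAt ne_zero_inf)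
    ((contDiffAt_scaledForm hΩ.smooth hD.smooth hρ hmt).differentiableAt ne_zero_inf)
    ((contDiffAt_comp_symm hρ.smooth hmt).differentiableAt ne_zero_inf)
    (by
      filter_upwards [target_mem_nhds hmt] with y hy
      exact mul_scaledForm_inChart hρ hy)
    (hD.lieDeriv_inChart m) (hΩ.extDeriv_inChart m) u v
  rw [fderiv_comp_symm_self hρ.smooth, fderiv_comp_symm_self hρ.smooth, inChart_form_self,
    inChart_form_self, Function.comp_apply, extChartAt_to_inv] at h
  exact h

end ScaledForm

section PullbackIdentities

variable {E : Type*} [NormedAddCommGroup E] [NormedSpace ℝ E]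
  {M : Type*} [TopologicalSpace M] [ChartedSpace E M]
  {F : Type*} [NormedAddCommGroup F] [NormedSpace ℝ F]
  {C : Type*} [TopologicalSpace C] [ChartedSpace F C]
  {Ω : DForm E M 2} {H : M → ℝ} {D : VField E M} {π : M → C} {ρ : M → ℝ}

theorem apply_tmap_of_pullback {η : DForm F C 1} (hpb : η.pullback π = scaledForm Ω D ρ) (m : M)
    (v : E) : η.val (π m) ![tmap E F π m v] = (ρ m)⁻¹ * Ω.val m ![D.val m, v] := by
  rw [← pullback_one_apply, hpb, scaledForm_apply]

/-- A form on the quotient is determined by its pull-back, since `dπ` is onto. -/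
theorem form_unique (hπ : IsQuotientBy (F := F) D π) {η η' : DForm F C 1}
    (h : η.pullback (E := E) π = η'.pullback π) : η = η' := by
  funext c
  obtain ⟨m, rfl⟩ := hπ.surjective c
  refine one_form_ext (E := F) fun w => ?_
  obtain ⟨v, rfl⟩ := tmap_surjective hπ.submersion m w
  have h1 := pullback_one_apply η π m v
  have h2 := pullback_one_apply η' π m v
  rw [h, h2] at h1
  exact h1.symm

variable [IsManifold 𝓘(ℝ, E) ∞ M] [IsManifold 𝓘(ℝ, F) ∞ C]

/-- The pull-back of `dη` is determined by `ρ π^*dη = Ω - dρ ∧ π^*η`. -/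
theorem mul_d_apply (hΩ : IsSymplectic Ω) (hD : IsScalingSymmetry Ω H D 1)
    (hπ : IsQuotientBy (F := F) D π) (hρ : IsScalingFunction D ρ) {η : DForm F C 1}
    (hη : η.Smooth) (hpb : η.pullback π = scaledForm Ω D ρ) (m : M) (u v : E) :
    ρ m * η.d.val (π m) ![tmap E F π m u, tmap E F π m v] =
      Ω.val m ![u, v] - (tmap E ℝ ρ m u * (scaledForm Ω D ρ).val m ![v] -
        tmap E ℝ ρ m v * (scaledForm Ω D ρ).val m ![u]) := by
  rw [d_pullback_apply hπ.submersion.contMDiff hη, hpb, extDeriv_scaledForm hΩ hD hρ]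

variable [FiniteDimensional ℝ E]

/-- If `η(u) = 0` and `dη(u, ·)` vanishes on `ker η`, then `Ω(ũ, ·)` vanishes on `ker Ω(D, ·)` for
a lift `ũ` of `u`, so `ũ` is a multiple of `D` and `u = 0`. -/
theorem isContactForm_of_pullback (hΩ : IsSymplectic Ω) (hD : IsScalingSymmetry Ω H D 1)
    (hπ : IsQuotientBy (F := F) D π) (hρ : IsScalingFunction D ρ) {η : DForm F C 1}
    (hη : η.Smooth) (hpb : η.pullback π = scaledForm Ω D ρ) : IsContactForm η := by
  refine ⟨hη, fun c h0 => ?_, fun c (u : F) hu huv => ?_⟩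
  · obtain ⟨m, rfl⟩ := hπ.surjective c
    refine field_ne_zero hρ m (hΩ.nondegenerate m (D m) fun (v : E) => ?_)
    have h1 := apply_tmap_of_pullback hpb m v
    have h2 : η.val (π m) = 0 := h0
    rw [h2] at h1
    exact (mul_eq_zero.1 h1.symm).resolve_left (inv_ne_zero (hρ.ne_zero m))
  · obtain ⟨m, rfl⟩ := hπ.surjective c
    obtain ⟨a, rfl⟩ := tmap_surjective hπ.submersion m u
    have hρm := hρ.ne_zero m
    have hΩa : Ω.val m ![D.val m, a] = 0 := by
      have h1 := apply_tmap_of_pullback hpb m a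
      rw [show η.val (π m) ![tmap E F π m a] = 0 from hu] at h1
      exact (mul_eq_zero.1 h1.symm).resolve_left (inv_ne_zero hρm)
    have hker : ∀ v, Ω.val m ![D.val m, v] = 0 → Ω.val m ![a, v] = 0 := by
      intro v hv
      have h1 := mul_d_apply hΩ hD hπ hρ hη hpb m a v
      have h2 : η.val (π m) ![tmap E F π m v] = 0 := by
        rw [apply_tmap_of_pullback hpb, hv, mul_zero]
      rw [show η.d.val (π m) ![tmap E F π m a, tmap E F π m v] = 0 from huv _ h2,
        scaledForm_apply, scaledForm_apply, hv, hΩa] at h1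
      simpa using h1.symm
    let B : E →L[ℝ] E →L[ℝ] ℝ :=
      (oneFormEquiv (E := E)).toContinuousLinearEquiv.toContinuousLinearMap.comp
        (Ω.val m).curryLeft
    have hB : ∀ u v, B u v = Ω.val m ![u, v] := fun u v => oneFormEquiv_apply _ v
    have hle : ⨅ _ : Unit, LinearMap.ker (B (D.val m)).toLinearMap ≤
        LinearMap.ker (B a).toLinearMap := by
      intro v hv
      rw [iInf_const] at hv
      have hv' : B (D.val m) v = 0 := hv
      rw [hB] at hv'
      exact (hB a v).trans (hker v hv')
    have hspan := mem_span_of_iInf_ker_le_ker hle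
    rw [Set.range_const, Submodule.mem_span_singleton] at hspan
    obtain ⟨k, hk⟩ := hspan
    have ha : a - k • D.val m = 0 := by
      refine hΩ.nondegenerate m (a - k • D.val m : E) fun (v : E) => ?_
      refine (hB _ v).symm.trans ?_
      rw [map_sub, map_smul]
      have := LinearMap.congr_fun hk v
      simp at this ⊢
      linarith
    rw [sub_eq_zero.1 ha, map_smul, tmap_proj_field hD.smooth hπ, smul_zero]
    rfl

end PullbackIdentities

section Descent

variable {E : Type*} [NormedAddCommGroup E] [NormedSpace ℝ E] [FiniteDimensional ℝ E]
  {M : Type*} [TopologicalSpace M] [ChartedSpace E M] [IsManifold 𝓘(ℝ, E) ∞ M] [T2Space M]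
  {F : Type*} [NormedAddCommGroup F] [NormedSpace ℝ F] [FiniteDimensional ℝ F]
  {C : Type*} [TopologicalSpace C] [ChartedSpace F C] [IsManifold 𝓘(ℝ, F) ∞ C]
  {Ω : DForm E M 2} {H : M → ℝ} {D : VField E M} {π : M → C} {ρ : M → ℝ}

/-- `λ / ρ` descends pointwise: it kills the vertical vectors, which are multiples of `D`, and is
invariant along `D`. -/
theorem scaledForm_eq_of_tmap_eq (hΩ : IsSymplectic Ω) (hD : IsScalingSymmetry Ω H D 1)
    (hπ : IsQuotientBy (F := F) D π) (hρ : IsScalingFunction D ρ) {m m' : M} (hm : π m = π m')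
    {v v' : E} (hv : tmap E F π m v = tmap E F π m' v') :
    (scaledForm Ω D ρ).val m ![v] = (scaledForm Ω D ρ).val m' ![v'] := by
  have hπs := hπ.submersion.contMDiff
  set β := scaledForm Ω D ρ
  set c := π m with hc
  have hvert : ∀ x (v : E), tmap E F π x v = 0 → oneFormEquiv (β.val x) v = 0 := by
    intro x v hv
    obtain ⟨a, rfl⟩ := exists_smul_of_tmap_eq_zero hD.smooth hπ (field_ne_zero hρ x) hv
    rw [map_smul, oneFormEquiv_apply, scaledForm_apply, alternating_two_self]
    simp
  -- Let `ψ` be the chart at `c`. At each point above its domain, `β = e ∘ d(ψ ∘ π)` for a unique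
  -- covector `e` on `F`; it remains to see that `e` is constant along integral curves.
  have hS : ∀ x, ∃ e : F →L[ℝ] ℝ, π x ∈ (extChartAt 𝓘(ℝ, F) c).source → ∀ v : E,
      β.val x ![v] = e (tmap F F (extChartAt 𝓘(ℝ, F) c) (π x) (tmap E F π x v)) := by
    intro x
    obtain ⟨S, hS⟩ := (tmap E F π x).toLinearMap.exists_rightInverse_of_surjective
      (LinearMap.range_eq_top.2 (tmap_surjective hπ.submersion x))
    let S₀ : F →L[ℝ] E := LinearMap.toContinuousLinearMap S
    have hS₀ : ∀ w, tmap E F π x (S₀ w) = w := fun w => LinearMap.congr_fun hS w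
    let B : F →L[ℝ] F := tmap F F (extChartAt 𝓘(ℝ, F) c).symm (extChartAt 𝓘(ℝ, F) c (π x))
    refine ⟨(oneFormEquiv (β.val x)).comp (S₀.comp B), fun hx v => ?_⟩
    have hB : ∀ w, B (tmap F F (extChartAt 𝓘(ℝ, F) c) (π x) w) = w := fun w => by
      have h := tmap_symm_chart_apply ((extChartAt 𝓘(ℝ, F) c).map_source hx) w
      rwa [(extChartAt 𝓘(ℝ, F) c).left_inv hx] at h
    rw [ContinuousLinearMap.comp_apply, ContinuousLinearMap.comp_apply, hB, ← oneFormEquiv_apply,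
      ← sub_eq_zero, ← map_sub]
    refine hvert x _ ?_
    rw [map_sub, hS₀, sub_self]
  choose e he using hS
  have hG : e m = e m' := by
    refine eq_on_fiber hπ (c := c) (fun x hx => ?_) rfl hm.symm
    have hxt := mem_extChartAt_target (I := 𝓘(ℝ, E)) x
    have hev := eventually_mem_charts (E := E) (F := F) hπs.continuous.continuousAt hx
    have hrep : ContDiffAt ℝ ∞ (rep E F π x c) (extChartAt 𝓘(ℝ, E) x x) :=
      contDiffAt_rep hxt hπs.contMDiffAt hev.self_of_nhds.2
    have hβ := (contDiffAt_scaledForm hΩ.smooth hD.smooth hρ hxt).differentiableAt ne_zero_inf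
    have hd := (hD.smooth.contDiffAt_inChart hxt).differentiableAt ne_zero_inf
    have hβe : ∀ᶠ y in 𝓝 (extChartAt 𝓘(ℝ, E) x x), ∀ v, β.inChart x y ![v] =
        (e ∘ (extChartAt 𝓘(ℝ, E) x).symm) y (fderiv ℝ (rep E F π x c) y v) := by
      filter_upwards [hev] with y hy v
      rw [inChart_one_apply, he _ hy.2, fderiv_rep hy.1 (hπs.mdifferentiableAt ne_zero_inf) hy.2]
      rfl
    have hsurj : Function.Surjective (fderiv ℝ (rep E F π x c) (extChartAt 𝓘(ℝ, E) x x)) := by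
      rw [fderiv_rep hxt (hπs.mdifferentiableAt ne_zero_inf) hev.self_of_nhds.2]
      simp only [extChartAt_to_inv, tmap_symm_self]
      rw [hx, tmap_chart_self]
      exact tmap_surjective hπ.submersion x
    have hed := differentiableAt_coeff hrep hβ hβe hsurj
    refine ⟨hed, fderiv_coeff_eq_zero hrep hd hβ hed
      (eventually_fderiv_rep_field hD.smooth hπ hx) hβe ?_ hsurj⟩
    refine lieDeriv_scaled_interior (W := Ω.inChart x)
      (r := ρ ∘ (extChartAt 𝓘(ℝ, E) x).symm)
      ((hΩ.smooth.contDiffAt_inChart hxt).differentiableAt ne_zero_inf) hd hβ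
      ((contDiffAt_comp_symm hρ.smooth hxt).differentiableAt ne_zero_inf) (hρ.ne_zero _) ?_ ?_
      (hD.lieDeriv_inChart x)
    · rw [fderiv_comp_symm_inChart hρ.smooth D hxt]
      exact hρ.scaling _
    · filter_upwards [target_mem_nhds hxt] with y hy
      exact mul_scaledForm_inChart hρ hy
  rw [he m (mem_extChartAt_source c), he m' (hm ▸ mem_extChartAt_source c), hG, ← hm, hv]

theorem exists_pullback_eq_scaledForm (hΩ : IsSymplectic Ω) (hD : IsScalingSymmetry Ω H D 1)
    (hπ : IsQuotientBy (F := F) D π) (hρ : IsScalingFunction D ρ) :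
    ∃ η : DForm F C 1, η.Smooth ∧ η.pullback π = scaledForm Ω D ρ := by
  let s := Function.surjInv hπ.surjective
  have hs : ∀ c, π (s c) = c := Function.surjInv_eq hπ.surjective
  have hS : ∀ c, ∃ S : F →L[ℝ] E, ∀ w, tmap E F π (s c) (S w) = w := by
    intro c
    obtain ⟨S, hS⟩ := (tmap E F π (s c)).toLinearMap.exists_rightInverse_of_surjective
      (LinearMap.range_eq_top.2 (tmap_surjective hπ.submersion (s c)))
    exact ⟨LinearMap.toContinuousLinearMap S, fun w => LinearMap.congr_fun hS w⟩
  choose S hS using hS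
  -- `η` at `c` is computed at a chosen point above `c`, by means of a right inverse of `dπ`;
  -- the result does not depend on these choices.
  let η : DForm F C 1 := fun c =>
    (oneFormEquiv.symm ((oneFormEquiv ((scaledForm Ω D ρ).val (s c))).comp (S c)) :
      F [⋀^Fin 1]→L[ℝ] ℝ)
  have hη : ∀ c w, η.val c ![w] = (scaledForm Ω D ρ).val (s c) ![S c w] := by
    intro c w
    rw [← oneFormEquiv_apply, ← oneFormEquiv_apply]
    change oneFormEquiv (oneFormEquiv.symm _) w = _
    rw [LinearIsometryEquiv.apply_symm_apply]
    rfl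
  have hpb : η.pullback π = scaledForm Ω D ρ := by
    funext m
    refine one_form_ext (E := E) fun v => ?_
    refine (pullback_one_apply η π m v).trans ?_
    rw [hη]
    exact scaledForm_eq_of_tmap_eq hΩ hD hπ hρ (hs _) (hS _ _)
  refine ⟨η, smooth_of_pullback (E := E) hπ.submersion hπ.surjective ?_, hpb⟩
  rw [hpb]
  exact scaledForm_smooth hΩ.smooth hD.smooth hρ

theorem existsUnique_contactForm (hΩ : IsSymplectic Ω) (hD : IsScalingSymmetry Ω H D 1)
    (hπ : IsQuotientBy (F := F) D π) (hρ : IsScalingFunction D ρ) :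
    ∃! η : DForm F C 1, IsContactForm η ∧ η.pullback π = scaledForm Ω D ρ := by
  obtain ⟨η, hη, hpb⟩ := exists_pullback_eq_scaledForm hΩ hD hπ hρ
  exact ⟨η, ⟨isContactForm_of_pullback hΩ hD hπ hρ hη hpb, hpb⟩,
    fun η' h' => form_unique hπ (h'.2.trans hpb.symm)⟩

end Descent

/-! ### The contact Hamiltonian -/

section Functions

variable {E : Type*} [NormedAddCommGroup E] [NormedSpace ℝ E]
  {M : Type*} [TopologicalSpace M] [ChartedSpace E M] [IsManifold 𝓘(ℝ, E) ∞ M]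
  {F : Type*} [NormedAddCommGroup F] [NormedSpace ℝ F]
  {C : Type*} [TopologicalSpace C] [ChartedSpace F C]

/-- The product rule for `ρ q = -H`. -/
theorem tmap_quotient {H ρ : M → ℝ} (hH : ContMDiff 𝓘(ℝ, E) 𝓘(ℝ, ℝ) ∞ H)
    (hρ : ContMDiff 𝓘(ℝ, E) 𝓘(ℝ, ℝ) ∞ ρ) {q : M → ℝ} (hq : ContMDiff 𝓘(ℝ, E) 𝓘(ℝ, ℝ) ∞ q)
    (hqρ : ∀ m, ρ m * q m = -H m) (m : M) (v : E) :
    ρ m * tmap E ℝ q m v + q m * tmap E ℝ ρ m v = -tmap E ℝ H m v := by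
  have hmt := mem_extChartAt_target (I := 𝓘(ℝ, E)) m
  have h : (fun y => (ρ ∘ (extChartAt 𝓘(ℝ, E) m).symm) y * (q ∘ (extChartAt 𝓘(ℝ, E) m).symm) y) =
      fun y => -(H ∘ (extChartAt 𝓘(ℝ, E) m).symm) y := funext fun y => hqρ _
  have h1 := congrArg (fun f => fderiv ℝ f (extChartAt 𝓘(ℝ, E) m m) v) h
  beta_reduce at h1
  rw [fderiv_fun_mul ((contDiffAt_comp_symm hρ hmt).differentiableAt ne_zero_inf)
    ((contDiffAt_comp_symm hq hmt).differentiableAt ne_zero_inf), fderiv_fun_neg,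
    add_apply, smul_apply, smul_apply, neg_apply, fderiv_comp_symm_self hρ,
    fderiv_comp_symm_self hq, fderiv_comp_symm_self hH, Function.comp_apply, Function.comp_apply,
    extChartAt_to_inv] at h1
  exact h1

/-- A smooth function with zero derivative along `D` descends to the quotient. -/
theorem existsUnique_descend {D : VField E M} {π : M → C}
    (hπ : IsQuotientBy (F := F) D π) {q : M → ℝ} (hq : ContMDiff 𝓘(ℝ, E) 𝓘(ℝ, ℝ) ∞ q)
    (hqD : ∀ m, tmap E ℝ q m (D.val m) = 0) :
    ∃! h : C → ℝ, ContMDiff 𝓘(ℝ, F) 𝓘(ℝ, ℝ) ∞ h ∧ ∀ m, h (π m) = q m := by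
  let s := Function.surjInv hπ.surjective
  have hs : ∀ c, π (s c) = c := Function.surjInv_eq hπ.surjective
  have hconst : ∀ m m', π m = π m' → q m = q m' := by
    intro m m' hm
    refine eq_on_fiber hπ (c := π m') (fun x _ => ?_) hm rfl
    have hxt := mem_extChartAt_target (I := 𝓘(ℝ, E)) x
    refine ⟨(contDiffAt_comp_symm hq hxt).differentiableAt ne_zero_inf, ?_⟩
    rw [fderiv_comp_symm_inChart hq D hxt, hqD]
  refine ⟨fun c => q (s c), ⟨fun c => ?_, fun m => hconst _ _ (hs _)⟩, fun h' h => ?_⟩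
  · obtain ⟨m, rfl⟩ := hπ.surjective c
    obtain ⟨σ, U, hU, hmU, -, hσ, hπσ⟩ := exists_local_section hπ.submersion m
    refine (ContMDiffAt.comp (π m) hq.contMDiffAt (hσ _ hmU)).congr_of_eventuallyEq ?_
    filter_upwards [hU.mem_nhds hmU] with c hc
    exact hconst _ _ ((hs c).trans (hπσ c hc).symm)
  · funext c
    rw [← h.2 (s c), hs]

variable {Ω : DForm E M 2} {H : M → ℝ} {D : VField E M} {π : M → C} {ρ : M → ℝ}

theorem existsUnique_contactHamiltonian (hH : ContMDiff 𝓘(ℝ, E) 𝓘(ℝ, ℝ) ∞ H)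
    (hD : IsScalingSymmetry Ω H D 1)
    (hπ : IsQuotientBy (F := F) D π) (hρ : IsScalingFunction D ρ) :
    ∃! h : C → ℝ, ContMDiff 𝓘(ℝ, F) 𝓘(ℝ, ℝ) ∞ h ∧ ∀ m, h (π m) = -H m / ρ m := by
  have hq : ContMDiff 𝓘(ℝ, E) 𝓘(ℝ, ℝ) ∞ fun m => -H m / ρ m := fun m => by
    rw [contMDiffAt_iff_contDiffAt_symm (mem_extChartAt_source m)]
    have hmt := mem_extChartAt_target (I := 𝓘(ℝ, E)) m
    exact (contDiffAt_comp_symm hH hmt).neg.div (contDiffAt_comp_symm hρ.smooth hmt)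
      (hρ.ne_zero _)
  refine existsUnique_descend hπ hq fun m => ?_
  have hρm := hρ.ne_zero m
  have h1 := tmap_quotient hH hρ.smooth hq (fun m => mul_div_cancel₀ _ (hρ.ne_zero m)) m (D.val m)
  rw [hD.tmap_apply, show tmap E ℝ ρ m (D.val m) = ρ m from hρ.scaling m,
    div_mul_cancel₀ _ hρm] at h1
  exact (mul_eq_zero.1 (by linarith)).resolve_left hρm

end Functions

section Contact

variable {E : Type*} [NormedAddCommGroup E] [NormedSpace ℝ E] [FiniteDimensional ℝ E]
  {M : Type*} [TopologicalSpace M] [ChartedSpace E M] [IsManifold 𝓘(ℝ, E) ∞ M]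
  {F : Type*} [NormedAddCommGroup F] [NormedSpace ℝ F]
  {C : Type*} [TopologicalSpace C] [ChartedSpace F C] [IsManifold 𝓘(ℝ, F) ∞ C]
  {Ω : DForm E M 2} {H : M → ℝ} {D : VField E M} {π : M → C} {ρ : M → ℝ}

theorem isContactHamiltonianVF_of_pullback (hΩ : IsSymplectic Ω)
    (hH : ContMDiff 𝓘(ℝ, E) 𝓘(ℝ, ℝ) ∞ H) (hD : IsScalingSymmetry Ω H D 1)
    (hπ : IsQuotientBy (F := F) D π) (hρ : IsScalingFunction D ρ) {X : VField F C}
    (hX : IsPushforward π (hamiltonianVF Ω H) X) {η : DForm F C 1} (hη : η.Smooth)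
    (hpb : η.pullback π = scaledForm Ω D ρ) {h : C → ℝ} (hh : ContMDiff 𝓘(ℝ, F) 𝓘(ℝ, ℝ) ∞ h)
    (hhH : ∀ m, h (π m) = -H m / ρ m) : IsContactHamiltonianVF η h X := by
  let s := Function.surjInv hπ.surjective
  have hs : ∀ c, π (s c) = c := Function.surjInv_eq hπ.surjective
  have hπs := hπ.submersion.contMDiff
  -- The Reeb field is the projection of the Hamiltonian field of `ρ`, as `-ρ / ρ = -1`.
  let R : VField F C := fun c => tmap E F π (s c) ((hamiltonianVF Ω ρ).val (s c))
  have key : ∀ c, ∃ m, π m = c ∧ R.val c = tmap E F π m ((hamiltonianVF Ω ρ).val m) :=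
    fun c => ⟨s c, hs c, rfl⟩
  have hq : ContMDiff 𝓘(ℝ, E) 𝓘(ℝ, ℝ) ∞ (h ∘ π) := hh.comp hπs
  have hdh : ∀ m (v : E), ρ m * tmap F ℝ h (π m) (tmap E F π m v) + h (π m) * tmap E ℝ ρ m v =
      -tmap E ℝ H m v := by
    intro m v
    have h1 := tmap_quotient hH hρ.smooth hq (fun m => by
      rw [Function.comp_apply, hhH, mul_div_cancel₀ _ (hρ.ne_zero m)]) m v
    rw [tmap_comp (hh.mdifferentiableAt ne_zero_inf) (hπs.mdifferentiableAt ne_zero_inf)] at h1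
    exact h1
  have hρD : ∀ m, tmap E ℝ ρ m (D.val m) = ρ m := hρ.scaling
  have hXρ : ∀ m, tmap E ℝ ρ m ((hamiltonianVF Ω ρ).val m) = 0 := fun m => by
    have h1 := hamiltonianVF_apply hΩ ρ m ((hamiltonianVF Ω ρ).val m)
    rw [alternating_two_self] at h1
    linarith
  have hβρ : ∀ m, (scaledForm Ω D ρ).val m ![(hamiltonianVF Ω ρ).val m] = 1 := fun m => by
    rw [scaledForm_apply, alternating_two_swap, hamiltonianVF_apply hΩ, neg_neg, hρD,
      inv_mul_cancel₀ (hρ.ne_zero m)]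
  have hβH : ∀ m, (scaledForm Ω D ρ).val m ![(hamiltonianVF Ω H).val m] = -h (π m) := fun m => by
    rw [scaledForm_apply, alternating_two_swap, hamiltonianVF_apply hΩ, neg_neg, hD.tmap_apply,
      hhH, neg_div, neg_neg, div_eq_inv_mul]
  have hXπ : ∀ m, X.val (π m) = tmap E F π m ((hamiltonianVF Ω H).val m) := fun m =>
    (hX.related m).symm
  have hηβ : ∀ m (v : E), η.val (π m) ![tmap E F π m v] = (scaledForm Ω D ρ).val m ![v] :=
    fun m v => by rw [← pullback_one_apply, hpb]
  refine ⟨R, ⟨fun c (w : F) => ?_, fun c => ?_⟩, fun c (w : F) => ?_, fun c => ?_⟩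
  · obtain ⟨m, rfl, hR⟩ := key c
    obtain ⟨v, rfl⟩ := tmap_surjective hπ.submersion m w
    have h1 := mul_d_apply hΩ hD hπ hρ hη hpb m ((hamiltonianVF Ω ρ).val m) v
    rw [hamiltonianVF_apply hΩ, hXρ, hβρ, ← hR] at h1
    exact (mul_eq_zero.1 (h1.trans (by ring))).resolve_left (hρ.ne_zero m)
  · obtain ⟨m, rfl, hR⟩ := key c
    change η.val (π m) ![R.val (π m)] = 1
    rw [hR, hηβ, hβρ]
  · obtain ⟨m, rfl, hR⟩ := key c
    obtain ⟨v, rfl⟩ := tmap_surjective hπ.submersion m w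
    change η.d.val (π m) ![X.val (π m), tmap E F π m v] = tmap F ℝ h (π m) (tmap E F π m v) -
      tmap F ℝ h (π m) (R.val (π m)) * η.val (π m) ![tmap E F π m v]
    have h1 := mul_d_apply hΩ hD hπ hρ hη hpb m ((hamiltonianVF Ω H).val m) v
    have h2 := hdh m v
    have h3 := hdh m ((hamiltonianVF Ω ρ).val m)
    rw [hXρ, ← hR] at h3
    -- `dρ(X_H) = -Ω(X_ρ, X_H) = Ω(X_H, X_ρ) = -dH(X_ρ)`
    have h4 := hamiltonianVF_apply hΩ ρ m ((hamiltonianVF Ω H).val m)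
    rw [alternating_two_swap, hamiltonianVF_apply hΩ] at h4
    rw [hamiltonianVF_apply hΩ, hβH, ← hXπ] at h1
    rw [hηβ]
    refine mul_left_cancel₀ (hρ.ne_zero m) ?_
    rw [h1]
    linear_combination -h2 + (scaledForm Ω D ρ).val m ![v] * (h3 - h4)
  · obtain ⟨m, rfl⟩ := hπ.surjective c
    change η.val (π m) ![X.val (π m)] = _
    rw [hXπ, hηβ, hβH]

end Contact

end ScalingReduction
end

open ScalingReduction in
theorem mainTheorem2
    {E : Type*} [NormedAddCommGroup E] [NormedSpace ℝ E] [FiniteDimensional ℝ E]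
    {M : Type*} [TopologicalSpace M] [ChartedSpace E M] [IsManifold 𝓘(ℝ, E) ∞ M] [T2Space M]
    {F : Type*} [NormedAddCommGroup F] [NormedSpace ℝ F] [FiniteDimensional ℝ F]
    {C : Type*} [TopologicalSpace C] [ChartedSpace F C] [IsManifold 𝓘(ℝ, F) ∞ C] [T2Space C]
    (Ω : DForm E M 2) (hΩ : IsSymplectic Ω)
    (H : M → ℝ) (hH : ContMDiff 𝓘(ℝ, E) 𝓘(ℝ, ℝ) ∞ H)
    (D : VField E M) (hD : IsScalingSymmetry Ω H D 1)
    (π : M → C) (hπ : IsQuotientBy (F := F) D π) :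
    (∃! X : VField F C, IsPushforward π (hamiltonianVF Ω H) X) ∧
    ∀ ρ : M → ℝ, IsScalingFunction D ρ →
      (∃! η : DForm F C 1, IsContactForm η ∧
        η.pullback π = fun m => (ρ m)⁻¹ • Ω.interior D m) ∧
      (∃! h : C → ℝ, ContMDiff 𝓘(ℝ, F) 𝓘(ℝ, ℝ) ∞ h ∧ ∀ m, h (π m) = -H m / ρ m) ∧
      ∀ (X : VField F C) (η : DForm F C 1) (h : C → ℝ),
        IsPushforward π (hamiltonianVF Ω H) X →
        (η.pullback π = fun m => (ρ m)⁻¹ • Ω.interior D m) →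
        (∀ m, h (π m) = -H m / ρ m) →
        IsContactHamiltonianVF η h X := by
  refine ⟨existsUnique_pushforward hΩ hH hD hπ, fun ρ hρ =>
    ⟨existsUnique_contactForm hΩ hD hπ hρ, existsUnique_contactHamiltonian hH hD hπ hρ,
      fun X η h hX hη hh => ?_⟩⟩
  obtain ⟨η', hη', hpb⟩ := exists_pullback_eq_scaledForm hΩ hD hπ hρ
  obtain rfl : η = η' := form_unique hπ (hη.trans hpb.symm)
  obtain ⟨h', ⟨hs, hh'⟩, -⟩ := existsUnique_contactHamiltonian hH hD hπ hρ
  obtain rfl : h = h' := funext fun c => by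
    obtain ⟨m, rfl⟩ := hπ.surjective c
    rw [hh, hh']
  exact isContactHamiltonianVF_of_pullback hΩ hH hD hπ hρ hX hη' hpb hs hh
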